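/- Let $F$ be a field of characteristic $0$, let $\Lambda$ be an abelian group (written additively) and let $l\ge 3$. Let $A_l=\{\varepsilon_i-\varepsilon_j : 1\le i,j\le l+1\}$ be the root system of type $A_l$ (including $0$), with root lattice $Q=\operatorname{Span}_{\mathbb Z}(A_l)$ and with $\langle\tau,\xi^\vee\rangle=\tau_i-\tau_j$ for $\xi=\varepsilon_i-\varepsilon_j\neq 0$. A Lie torus of type $(A_l,\Lambda)$ is a Lie algebra $L$ over $F$ with a decomposition $L=\bigoplus_{q\in Q,\,\lambda\in\Lambda}L_q^\lambda$, $[L_q^\lambda,L_p^\mu]\subset L_{q+p}^{\lambda+\mu}$, such that, with $L_q=\bigoplus_\lambda L_q^\lambda$ and $L^\lambda=\bigoplus_q L_q^\lambda$: (1) $L_q\ne 0$ implies $q\in A_l$; (2) if $0\neq\xi\in A_l$ and $L_\xi^\lambda\neq 0$, there are $e\in L_\xi^\lambda$, $f\in L_{-\xi}^{-\lambda}$ with $L_\xi^\lambda=Fe$, $L_{-\xi}^{-\lambda}=Ff$ and $[[e,f],x]=\langle\tau,\xi^\vee\rangle x$ for all $\tau\in A_l$ and $x\in L_\tau$; (3)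 $L_\xi^0\ne 0$ for all $0\ne\xi\in A_l$, the Lie algebra $L$ is generated by $\bigcup_{0\ne\xi\in A_l}L_\xi$, and $\Lambda$ is generated by $\{\lambda : L^\lambda\ne 0\}$. It is centreless if its centre is $0$, and invariant if $L$ has a nondegenerate symmetric bilinear form $(\cdot|\cdot)$ with $([x,y]|z)=(x|[y,z])$ and $(L_\xi^\lambda|L_\tau^\mu)=0$ whenever $\lambda+\mu\neq 0$ or $\xi+\tau\neq 0$. An associative torus of type $\Lambda$ is a nonzero unital associative $\Lambda$-graded $F$-algebra $A=\bigoplus_{\lambda\in\Lambda}A^\lambda$ such that every nonzero $A^\lambda$ contains an invertible element, $\dim A^\lambda\le 1$ for all $\lambda$, and $\Lambda$ is generated by $\{\lambda : A^\lambda\neq 0\}$. For such $A$ put $\mathfrak{sl}_{l+1}(A)=[\mathfrak{gl}_{l+1}(A),\mathfrak{gl}_{l+1}(A)]$, and let $\mathfrak{sl}_{l+1}(A)_q^\lambda$ be the space of matrices in $\mathfrak{sl}_{l+1}(A)$ which have all entries in $A^\lambda$ and whose nonzero entries occur only at positions $(i,j)$ with $\varepsilon_i-\varepsilon_j=q$.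 Theorem. A Lie algebra $L$ over $F$ with given subspaces $L_q^\lambda$ ($q\in Q$, $\lambda\in\Lambda$) is a centreless Lie torus of type $(A_l,\Lambda)$ if and only if it is graded-isomorphic to $\mathfrak{sl}_{l+1}(A)$ for some associative torus $A$ of type $\Lambda$, that is, there is an isomorphism of Lie algebras $f:L\to\mathfrak{sl}_{l+1}(A)$ with $f(L_q^\lambda)=\mathfrak{sl}_{l+1}(A)_q^\lambda$ for all $q\in Q$, $\lambda\in\Lambda$. In this case, $L$ is an invariant Lie torus. -/

import Mathlib

/-! ### The root system of type `A_l`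

Roots `ε_i - ε_j` in the space of vectors of `F^(l+1)` with coordinate sum `0`, where coroots are
identified with roots through the dot product. -/

/-- The space of vectors in `F^(l+1)` with coordinate sum zero. -/
def typeASpace (F : Type*) [Field F] (l : ℕ) : Submodule F (Fin (l + 1) → F) where
  carrier := {v | ∑ i, v i = 0}
  add_mem' {v w} hv hw := by
    simp only [Set.mem_ofPred_eq] at hv hw ⊢
    simp [Finset.sum_add_distrib, hv, hw]
  zero_mem' := by simp
  smul_mem' c v hv := by
    simp only [Set.mem_ofPred_eq] at hv ⊢
    simp [← Finset.mul_sum, hv]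

/-- The vector `ε_i - ε_j` (which is `0` for `i = j`). -/
def typeADiff (F : Type*) [Field F] (l : ℕ) (i j : Fin (l + 1)) : typeASpace F l :=
  ⟨Pi.single i 1 - Pi.single j 1, by
    change ∑ k, (Pi.single i (1 : F) - Pi.single j 1 : Fin (l + 1) → F) k = 0
    simp [Finset.sum_sub_distrib]⟩

/-- The dot product on the space of vectors with coordinate sum zero. -/
def typeAForm (F : Type*) [Field F] (l : ℕ) :
    typeASpace F l →ₗ[F] typeASpace F l →ₗ[F] F :=
  LinearMap.mk₂ F (fun x y => ∑ i, x.1 i * y.1 i)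
    (fun x y z => by simp [add_mul, Finset.sum_add_distrib])
    (fun c x y => by simp [Finset.mul_sum, mul_assoc])
    (fun x y z => by simp [mul_add, Finset.sum_add_distrib])
    (fun c x y => by simp [Finset.mul_sum, mul_left_comm])

theorem typeAForm_diff (F : Type*) [Field F] (l : ℕ) (x : typeASpace F l) (i j : Fin (l + 1)) :
    typeAForm F l x (typeADiff F l i j) = x.1 i - x.1 j := by
  simp [typeAForm, typeADiff, mul_sub, Finset.sum_sub_distrib, Pi.single_apply]

theorem typeAForm_comm (F : Type*) [Field F] (l : ℕ) (x y : typeASpace F l) :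
    typeAForm F l x y = typeAForm F l y x := by
  simp [typeAForm, mul_comm]

theorem typeAForm_injective (F : Type*) [Field F] [CharZero F] (l : ℕ) :
    Function.Injective (typeAForm F l) := by
  rw [injective_iff_map_eq_zero]
  intro x hx
  have h : ∀ i j, x.1 i = x.1 j := fun i j => by
    have := typeAForm_diff F l x i j
    rw [hx] at this
    exact (sub_eq_zero.mp this.symm)
  have hs : ∑ i, x.1 i = 0 := x.2
  ext i
  have h2 : ∑ k, x.1 k = (l + 1 : F) * x.1 i := by
    rw [Finset.sum_congr rfl (fun k _ => h k i)]
    simp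
  rw [hs] at h2
  rcases mul_eq_zero.mp h2.symm with h3 | h3
  · exact absurd h3 (Nat.cast_add_one_ne_zero l)
  · exact h3

instance typeAForm_isPerfPair (F : Type*) [Field F] [CharZero F] (l : ℕ) :
    (typeAForm F l).IsPerfPair :=
  LinearMap.IsPerfPair.of_injective (typeAForm_injective F l) (by
    intro x y hxy
    apply typeAForm_injective F l
    ext z
    rw [typeAForm_comm, typeAForm_comm F l y]
    exact LinearMap.congr_fun hxy z)

/-- The index set of the roots of type `A_l`: pairs `(i, j)` with `i ≠ j`. -/
abbrev TypeAIndex (l : ℕ) : Type := {p : Fin (l + 1) × Fin (l + 1) // p.1 ≠ p.2}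

/-- The roots `ε_i - ε_j`, `i ≠ j`. -/
def typeARoot (F : Type*) [Field F] [CharZero F] (l : ℕ) : TypeAIndex l ↪ typeASpace F l where
  toFun p := typeADiff F l p.1.1 p.1.2
  inj' := by
    rintro ⟨⟨a, b⟩, hab⟩ ⟨⟨c, d⟩, hcd⟩ h
    have h' : ∀ k, (Pi.single a (1 : F) - Pi.single b 1 : Fin (l + 1) → F) k
        = (Pi.single c (1 : F) - Pi.single d 1 : Fin (l + 1) → F) k :=
      fun k => congrFun (congrArg Subtype.val h) k
    have h1 := h' a
    have h2 := h' b
    simp only at hab hcd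
    simp only [Pi.sub_apply, Pi.single_apply, if_true, if_neg hab, if_neg hab.symm] at h1 h2
    have hac : a = c := by
      by_contra hc
      rw [if_neg hc] at h1
      split_ifs at h1
      · have : (2 : F) = 0 := by linear_combination h1
        exact two_ne_zero this
      · simp at h1
    have hbd : b = d := by
      by_contra hc
      rw [if_neg hc] at h2
      split_ifs at h2
      · have : (2 : F) = 0 := by linear_combination -h2
        exact two_ne_zero this
      · simp at h2
    subst hac hbd
    rfl

/-- The permutation of the roots of type `A_l` induced by swapping two coordinates. -/
def typeAPerm (l : ℕ) (p : TypeAIndex l) : TypeAIndex l ≃ TypeAIndex l :=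
  (Equiv.prodCongr (Equiv.swap p.1.1 p.1.2) (Equiv.swap p.1.1 p.1.2)).subtypeEquiv
    (fun q => by simp)

theorem typeA_reflection (F : Type*) [Field F] [CharZero F] (l : ℕ) (p q : TypeAIndex l) :
    typeARoot F l q - typeAForm F l (typeARoot F l q) (typeARoot F l p) • typeARoot F l p
      = typeARoot F l (typeAPerm l p q) := by
  obtain ⟨⟨a, b⟩, hab⟩ := p
  obtain ⟨⟨c, d⟩, hcd⟩ := q
  simp only at hab hcd
  have e : ∀ x : TypeAIndex l, typeARoot F l x = typeADiff F l x.1.1 x.1.2 := fun _ => rfl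
  simp only [e, typeAForm_diff]
  ext k
  simp only [typeADiff, typeAPerm, Equiv.subtypeEquiv_apply, Equiv.prodCongr_apply, Prod.map,
    Submodule.coe_sub, Submodule.coe_smul, Pi.sub_apply, Pi.smul_apply, smul_eq_mul,
    Pi.single_apply, Equiv.swap_apply_def]
  grind

/-- The root system of type `A_l`. -/
def typeA (F : Type*) [Field F] [CharZero F] (l : ℕ) :
    RootPairing (TypeAIndex l) F (typeASpace F l) (typeASpace F l) where
  toLinearMap := typeAForm F l
  isPerfPair_toLinearMap := typeAForm_isPerfPair F l
  root := typeARoot F l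
  coroot := typeARoot F l
  root_coroot_two := by
    rintro ⟨⟨a, b⟩, hab⟩
    simp only at hab
    have e : ∀ x : TypeAIndex l, typeARoot F l x = typeADiff F l x.1.1 x.1.2 := fun _ => rfl
    simp only [e, typeAForm_diff]
    simp [typeADiff, hab, hab.symm]
    norm_num
  reflectionPerm := typeAPerm l
  reflectionPerm_root := typeA_reflection F l
  reflectionPerm_coroot p q := by
    rw [typeAForm_comm]
    exact typeA_reflection F l p q

theorem typeARoot_span (F : Type*) [Field F] [CharZero F] (l : ℕ) :
    Submodule.span F (Set.range (typeARoot F l)) = ⊤ := by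
  rw [eq_top_iff]
  rintro x -
  have hx : x = ∑ i, x.1 i • typeADiff F l i 0 := by
    have hs : ∑ i, x.1 i = 0 := x.2
    ext k
    simp only [typeADiff, Submodule.coe_sum, Submodule.coe_smul, Finset.sum_apply, Pi.smul_apply,
      Pi.sub_apply, smul_eq_mul, mul_sub, Finset.sum_sub_distrib, ← Finset.sum_mul, hs]
    simp [Pi.single_apply]
  rw [hx]
  refine Submodule.sum_mem _ fun i _ => Submodule.smul_mem _ _ ?_
  by_cases h : i = 0
  · subst h
    have : typeADiff F l 0 0 = 0 := by ext; simp [typeADiff]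
    rw [this]
    exact Submodule.zero_mem _
  · exact Submodule.subset_span ⟨⟨(i, 0), h⟩, rfl⟩

instance typeA_isRootSystem (F : Type*) [Field F] [CharZero F] (l : ℕ) :
    (typeA F l).IsRootSystem where
  span_root_eq_top := typeARoot_span F l
  span_coroot_eq_top := typeARoot_span F l

/-! ### Lie tori

`P` is a (finite, irreducible, possibly non-reduced) root system over `F` without the root `0`,
so that `S = {0} ∪ Set.range P.root`. The root lattice is `P.rootSpan ℤ`, and `⟨τ, ξ^∨⟩` is
`P.toLinearMap τ (P.coroot i)` for `ξ = P.root i`. -/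

section LieTorus

variable {ι F Y Y' Λ L L' : Type*} [Field F] [CharZero F]
  [AddCommGroup Y] [Module F Y] [AddCommGroup Y'] [Module F Y'] [AddCommGroup Λ]
  [LieRing L] [LieAlgebra F L] [LieRing L'] [LieAlgebra F L']

/-- The subspaces `𝓛 q a = L_q^a` make `L` a Lie algebra with compatible gradings by the root
lattice and by `Λ`. -/
structure IsBigradedLieAlgebra (P : RootPairing ι F Y Y')
    (𝓛 : P.rootSpan ℤ → Λ → Submodule F L) : Prop where
  indep : iSupIndep fun x : P.rootSpan ℤ × Λ => 𝓛 x.1 x.2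
  iSup_eq_top : ⨆ x : P.rootSpan ℤ × Λ, 𝓛 x.1 x.2 = ⊤
  lie_mem : ∀ (p q : P.rootSpan ℤ) (a b : Λ), ∀ x ∈ 𝓛 p a, ∀ y ∈ 𝓛 q b,
    ⁅x, y⁆ ∈ 𝓛 (p + q) (a + b)

/-- `L`, with the homogeneous subspaces `𝓛 q a = L_q^a`, is a Lie torus of type `(S, Λ)`, where `S`
is the root system `P` together with `0`. -/
structure IsLieTorus (P : RootPairing ι F Y Y')
    (𝓛 : P.rootSpan ℤ → Λ → Submodule F L) : Prop extends IsBigradedLieAlgebra P 𝓛 where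
  /-- the support of the grading by the root lattice is contained in `S` -/
  supp_subset : ∀ q : P.rootSpan ℤ, (⨆ a, 𝓛 q a) ≠ ⊥ →
    q = 0 ∨ (q : Y) ∈ Set.range P.root
  exists_sl2 : ∀ (i : ι) (a : Λ), 𝓛 (P.rootSpanMem ℤ i) a ≠ ⊥ →
    ∃ e f : L, 𝓛 (P.rootSpanMem ℤ i) a = F ∙ e ∧ 𝓛 (-P.rootSpanMem ℤ i) (-a) = F ∙ f ∧
      ∀ τ : P.rootSpan ℤ, ∀ x ∈ ⨆ b, 𝓛 τ b,
        ⁅⁅e, f⁆, x⁆ = P.toLinearMap (τ : Y) (P.coroot i) • x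
  /-- indivisible roots occur in degree `0` -/
  indivisible_ne_bot : ∀ i : ι, (∀ j : ι, P.root i ≠ (2 : ℤ) • P.root j) →
    𝓛 (P.rootSpanMem ℤ i) 0 ≠ ⊥
  generated : LieSubalgebra.lieSpan F L
    (⋃ i : ι, ((⨆ a, 𝓛 (P.rootSpanMem ℤ i) a : Submodule F L) : Set L)) = ⊤
  closure_supp : AddSubgroup.closure {a : Λ | (⨆ q, 𝓛 q a) ≠ ⊥} = ⊤

/-- A Lie torus with an invariant nondegenerate symmetric graded bilinear form. -/
def IsInvariantLieTorus (P : RootPairing ι F Y Y')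
    (𝓛 : P.rootSpan ℤ → Λ → Submodule F L) : Prop :=
  IsLieTorus P 𝓛 ∧ ∃ B : L →ₗ[F] L →ₗ[F] F,
    (∀ x y, B x y = B y x) ∧
    (∀ x y z, B ⁅x, y⁆ z = B x ⁅y, z⁆) ∧
    (∀ x, (∀ y, B x y = 0) → x = 0) ∧
    ∀ (p q : P.rootSpan ℤ) (a b : Λ), a + b ≠ 0 ∨ p + q ≠ 0 →
      ∀ x ∈ 𝓛 p a, ∀ y ∈ 𝓛 q b, B x y = 0

/-- There is an isomorphism of Lie algebras matching the homogeneous subspaces. -/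
def IsGradedIsomorphic (P : RootPairing ι F Y Y')
    (𝓛 : P.rootSpan ℤ → Λ → Submodule F L) (𝓛' : P.rootSpan ℤ → Λ → Submodule F L') : Prop :=
  ∃ f : L ≃ₗ⁅F⁆ L', ∀ (q : P.rootSpan ℤ) (a : Λ),
    (𝓛 q a).map (f : L →ₗ[F] L') = 𝓛' q a

end LieTorus

/-! ### Associative tori -/

/-- `A`, with the homogeneous subspaces `𝒜 a`, is an associative torus of type `Λ`. -/
structure IsAssociativeTorus {F A Λ : Type*} [Field F] [Ring A] [Algebra F A] [AddCommGroup Λ]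
    (𝒜 : Λ → Submodule F A) : Prop where
  nontrivial : Nontrivial A
  indep : iSupIndep 𝒜
  iSup_eq_top : ⨆ a, 𝒜 a = ⊤
  mul_mem : ∀ (a b : Λ), ∀ x ∈ 𝒜 a, ∀ y ∈ 𝒜 b, x * y ∈ 𝒜 (a + b)
  exists_isUnit : ∀ a, 𝒜 a ≠ ⊥ → ∃ x ∈ 𝒜 a, IsUnit x
  rank_le_one : ∀ a, Module.rank F (𝒜 a) ≤ 1
  closure_supp : AddSubgroup.closure {a : Λ | 𝒜 a ≠ ⊥} = ⊤

/-! ### The Lie algebra `sl_(l+1)(A)` -/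

attribute [local instance] LieRing.ofAssociativeRing

section SpecialLinear

variable (F : Type*) [Field F] [CharZero F] (l : ℕ) (A : Type*) [Ring A] [Algebra F A]
  {Λ : Type*}

/-- `sl_(l+1)(A) = [gl_(l+1)(A), gl_(l+1)(A)]`, the derived algebra of the Lie algebra of matrices
with entries in `A`. -/
abbrev slAlg : LieIdeal F (Matrix (Fin (l + 1)) (Fin (l + 1)) A) :=
  ⁅(⊤ : LieIdeal F (Matrix (Fin (l + 1)) (Fin (l + 1)) A)),
    (⊤ : LieIdeal F (Matrix (Fin (l + 1)) (Fin (l + 1)) A))⁆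

/-- The subspace `sl_(l+1)(A)_q`: matrices whose nonzero entries occur only at positions `(i, j)`
with `ε_i - ε_j = q`. -/
def slRootSpace (q : (typeA F l).rootSpan ℤ) : Submodule F (slAlg F l A) where
  carrier := {x | ∀ i j, x.1 i j ≠ 0 → typeADiff F l i j = q}
  add_mem' {x y} hx hy i j h := by
    by_cases hxz : x.1 i j = 0
    · exact hy i j fun hyz => h (by
        change x.1 i j + y.1 i j = 0
        rw [hxz, hyz, add_zero])
    · exact hx i j hxz
  zero_mem' i j h := absurd rfl h
  smul_mem' c x hx i j h := hx i j fun hz => h (by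
    change c • x.1 i j = 0
    rw [hz, smul_zero])

variable {A}

/-- The subspace `sl_(l+1)(A)^a`: matrices with all entries in `A^a`. -/
def slDegree (𝒜 : Λ → Submodule F A) (a : Λ) : Submodule F (slAlg F l A) where
  carrier := {x | ∀ i j, x.1 i j ∈ 𝒜 a}
  add_mem' hx hy i j := (𝒜 a).add_mem (hx i j) (hy i j)
  zero_mem' _ _ := (𝒜 a).zero_mem
  smul_mem' c _ hx i j := (𝒜 a).smul_mem c (hx i j)

/-- The homogeneous subspaces `sl_(l+1)(A)_q^a = sl_(l+1)(A)_q ∩ sl_(l+1)(A)^a`. -/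
def slGrading (𝒜 : Λ → Submodule F A) (q : (typeA F l).rootSpan ℤ) (a : Λ) :
    Submodule F (slAlg F l A) :=
  slRootSpace F l A q ⊓ slDegree F l 𝒜 a

end SpecialLinear

universe u

/-! In an associative torus A every nonzero homogeneous a has a homogeneous inverse, so a E_ij and
a⁻¹ E_ji have bracket E_ii - E_jj and serve as sl₂-pairs. A also carries a linear form ε with ε(1) =
1 and ε(xy) = ε(yx) which vanishes in nonzero degrees (`IsAssociativeTorus.exists_trace`). It
excludes nonzero central sums of commutators (`eq_zero_of_central`), so sl_(l+1)(A) is centreless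
(`slAlg_eq_zero`), and ε(tr(xy)) is the invariant form (`exists_form`).

Conversely, let L be a centreless Lie torus. The engine is `IsLieTorus.lie_assoc`: if the roots of x
and z do not add up to a root or 0, then [x,z] = 0 and the Jacobi identity becomes associativity,
[[x,y],z] = [x,[y,z]]. The sl₂-pairs of degree 0 yield matrix units u_ij (`exists_matrixUnits`). An
element of one root component spreads, by bracketing with matrix units, to a unique compatible
family (a_ij), playing the role of all a E_ij at once (`coordSpace.exists_apply_eq`,
`coordSpace.eq_of_apply_eq`). These families form the algebra A, with (ab)_ik = [a_ij, b_jk]. The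
value does not depend on j, and l ≥ 3 supplies the four distinct indices that give associativity
(`coordMul_assoc`). The sl₂-pairs of L supply invertible elements (`exists_coordInv`).

The isomorphism L → sl_(l+1)(A) is built as a graph in L × sl_(l+1)(A). Over roots it consists of
the pairs (a_ij, a E_ij); over the root 0, of the pairs whose adjoint action preserves these. The
graph is a Lie subalgebra (`IsRootGraph.lie_lie_mem` is the essential case), it projects onto both
factors because root components generate, and both projections are injective because the two
algebras are centreless. The invariant form is pulled back along the isomorphism. -/

/-! ### Graded projections -/

section Projection

variable {R M ι : Type*} [CommRing R] [AddCommGroup M] [Module R M]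

/-- The homogeneous projections of an internal direct sum decomposition. -/
theorem exists_homogeneous_proj (p : ι → Submodule R M) (hi : iSupIndep p) (ht : ⨆ i, p i = ⊤) :
    ∃ π : ι → M →ₗ[R] M, (∀ i x, π i x ∈ p i) ∧ (∀ i, ∀ x ∈ p i, π i x = x) ∧
      (∀ i j, j ≠ i → ∀ x ∈ p j, π i x = 0) ∧ ∀ x, (∀ i, π i x = 0) → x = 0 := by
  classical
  have hint := DirectSum.isInternal_submodule_of_iSupIndep_of_iSup_eq_top hi ht
  let _ := hint.chooseDecomposition
  refine ⟨fun i => (p i).subtype ∘ₗ (DirectSum.component R ι (fun i => p i) i) ∘ₗ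
    (DirectSum.decomposeLinearEquiv p).toLinearMap, fun i x => ?_, fun i x hx => ?_,
    fun i j hij x hx => ?_, fun x hx => ?_⟩
  · simp
  · exact DirectSum.decompose_of_mem_same p hx
  · exact DirectSum.decompose_of_mem_ne p hx hij
  · apply (DirectSum.decompose p).injective
    rw [DirectSum.decompose_zero]
    exact DFinsupp.ext fun i => Subtype.ext (hx i)

theorem linearMap_ext_of_iSup_eq_top {N : Type*} [AddCommGroup N] [Module R N]
    (p : ι → Submodule R M) (ht : ⨆ i, p i = ⊤) {f g : M →ₗ[R] N}
    (h : ∀ i, ∀ x ∈ p i, f x = g x) : f = g := by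
  ext x
  have hx : x ∈ ⨆ i, p i := by rw [ht]; trivial
  induction hx using Submodule.iSup_induction' with
  | mem i x hx => exact h i x hx
  | zero => simp
  | add x y _ _ hx hy => simp [hx, hy]

end Projection

/-! ### The root lattice of type `A_l` -/

section Lattice

variable (F : Type*) [Field F] [CharZero F] {l : ℕ}

/-- The element `ε_i - ε_j` of the root lattice. -/
def latticeDiff (i j : Fin (l + 1)) : (typeA F l).rootSpan ℤ :=
  ⟨typeADiff F l i j, by
    by_cases h : i = j
    · subst h
      have : typeADiff F l i i = 0 := by ext; simp [typeADiff]
      rw [this]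
      exact Submodule.zero_mem _
    · exact Submodule.subset_span ⟨⟨(i, j), h⟩, rfl⟩⟩

variable {F}

theorem latticeDiff_coe_apply (i j k : Fin (l + 1)) :
    ((latticeDiff F i j : (typeA F l).rootSpan ℤ) : typeASpace F l).1 k =
      (if k = i then 1 else 0) - (if k = j then 1 else 0) := by
  simp [latticeDiff, typeADiff, Pi.single_apply]

theorem lattice_ext {p q : (typeA F l).rootSpan ℤ}
    (h : ∀ k, (p : typeASpace F l).1 k = (q : typeASpace F l).1 k) : p = q :=
  Subtype.ext (Subtype.ext (funext h))

@[simp] theorem latticeDiff_self (i : Fin (l + 1)) : latticeDiff F i i = 0 :=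
  lattice_ext fun k => by
    rw [latticeDiff_coe_apply, sub_self]; rfl

theorem latticeDiff_add (i j k : Fin (l + 1)) :
    latticeDiff F i j + latticeDiff F j k = latticeDiff F i k :=
  lattice_ext fun m => by
    have : ∀ p q : (typeA F l).rootSpan ℤ, ((p + q : (typeA F l).rootSpan ℤ) : typeASpace F l).1 m
      = (p : typeASpace F l).1 m + (q : typeASpace F l).1 m := fun _ _ => rfl
    rw [this]
    simp only [latticeDiff_coe_apply]
    ring

theorem latticeDiff_neg (i j : Fin (l + 1)) : -latticeDiff F i j = latticeDiff F j i := by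
  rw [neg_eq_iff_add_eq_zero, latticeDiff_add, latticeDiff_self]

theorem latticeDiff_ne_zero {i j : Fin (l + 1)} (h : i ≠ j) : latticeDiff F i j ≠ 0 := by
  intro h0
  have := congrArg (fun p : (typeA F l).rootSpan ℤ => (p : typeASpace F l).1 i) h0
  simp only [latticeDiff_coe_apply, if_neg h] at this
  simp at this

theorem latticeDiff_inj {i j k m : Fin (l + 1)} (h : i ≠ j)
    (e : latticeDiff F i j = latticeDiff F k m) : k = i ∧ m = j := by
  have key : ∀ n, (if n = i then (1 : F) else 0) - (if n = j then 1 else 0) =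
      (if n = k then 1 else 0) - (if n = m then 1 else 0) := fun n => by
    have := congrArg (fun p : (typeA F l).rootSpan ℤ => (p : typeASpace F l).1 n) e
    simpa only [latticeDiff_coe_apply] using this
  have h2 : (2 : F) ≠ 0 := two_ne_zero
  have h1 := key i
  have h3 := key j
  grind

/-- Look at coordinates i and k, which the negative terms do not touch. If i = k the coordinate is
2, while a difference has only coordinates 0, 1, -1. If i ≠ k both coordinates are 1, while a
difference has at most one coordinate 1. This is the source of all vanishing brackets. -/
theorem latticeDiff_add_latticeDiff_ne {i j k m : Fin (l + 1)} (h1 : i ≠ j) (h2 : i ≠ m)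
    (h3 : k ≠ j) (h4 : k ≠ m) (r s : Fin (l + 1)) :
    latticeDiff F i j + latticeDiff F k m ≠ latticeDiff F r s := by
  intro e
  have key : ∀ n, ((if n = i then (1 : F) else 0) - (if n = j then 1 else 0)) +
      ((if n = k then 1 else 0) - (if n = m then 1 else 0)) =
      (if n = r then 1 else 0) - (if n = s then 1 else 0) := fun n => by
    have := congrArg (fun p : (typeA F l).rootSpan ℤ => (p : typeASpace F l).1 n) e
    have hadd : ∀ p q : (typeA F l).rootSpan ℤ,
      ((p + q : (typeA F l).rootSpan ℤ) : typeASpace F l).1 n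
      = (p : typeASpace F l).1 n + (q : typeASpace F l).1 n := fun _ _ => rfl
    simpa only [latticeDiff_coe_apply, hadd] using this
  have h2' : (2 : F) ≠ 0 := two_ne_zero
  have h3' : (3 : F) ≠ 0 := three_ne_zero
  have k1 := key i
  have k2 := key k
  grind

/-- The pairing of `ε_p - ε_q` with the coroot of `ε_i - ε_j`. -/
theorem typeA_pairing (τ : (typeA F l).rootSpan ℤ) (p : TypeAIndex l) :
    (typeA F l).toLinearMap (τ : typeASpace F l) ((typeA F l).coroot p) =
      (τ : typeASpace F l).1 p.1.1 - (τ : typeASpace F l).1 p.1.2 :=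
  typeAForm_diff F l τ p.1.1 p.1.2

end Lattice

/-! ### Associative tori -/

section AssociativeTorus

variable {F A Λ : Type*} [Field F] [Ring A] [Algebra F A] [AddCommGroup Λ]
  {𝒜 : Λ → Submodule F A}

/-- Comparing components of degree b in x · 1 = x, for x of degree b, shows that the degree-0
component of 1 is already a right identity, hence equals 1. -/
theorem IsAssociativeTorus.one_mem (h : IsAssociativeTorus 𝒜) : (1 : A) ∈ 𝒜 0 := by
  obtain ⟨π, h1, h2, h3, h4⟩ := exists_homogeneous_proj 𝒜 h.indep h.iSup_eq_top
  have key : ∀ x : A, x * π 0 1 = x := by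
    have : LinearMap.mulRight F (π 0 1) = LinearMap.id := by
      refine linearMap_ext_of_iSup_eq_top 𝒜 h.iSup_eq_top fun b x hx => ?_
      have : (π b) ∘ₗ (LinearMap.mulLeft F x) = (LinearMap.mulLeft F x) ∘ₗ (π 0) := by
        refine linearMap_ext_of_iSup_eq_top 𝒜 h.iSup_eq_top fun c y hy => ?_
        have hm := h.mul_mem _ _ x hx y hy
        by_cases hc : c = 0
        · subst hc
          simp [h2 _ y hy, h2 b (x * y) (by simpa using hm)]
        · simp [h3 0 c hc y hy, h3 b (b + c) (by simpa using hc) _ hm]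
      have := LinearMap.congr_fun this 1
      simp only [LinearMap.comp_apply, LinearMap.mulLeft_apply, mul_one, h2 b x hx] at this
      simpa using this.symm
    exact fun x => by simpa using LinearMap.congr_fun this x
  have := key 1
  rw [one_mul] at this
  rw [← this]
  exact h1 0 1

theorem IsAssociativeTorus.eq_smul (h : IsAssociativeTorus 𝒜) {a : Λ} {x y : A} (hx : x ∈ 𝒜 a)
    (hx0 : x ≠ 0) (hy : y ∈ 𝒜 a) : ∃ t : F, y = t • x := by
  have := (rank_submodule_le_one_iff' (𝒜 a)).mp (h.rank_le_one a)
  obtain ⟨v, hv⟩ := this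
  obtain ⟨s, rfl⟩ := Submodule.mem_span_singleton.mp (hv hx)
  obtain ⟨t, rfl⟩ := Submodule.mem_span_singleton.mp (hv hy)
  have hs : s ≠ 0 := by rintro rfl; simp at hx0
  exact ⟨t / s, by rw [smul_smul, div_mul_cancel₀ _ hs]⟩

/-- By one-dimensionality x is a scalar multiple of a unit u. The inverse of u is homogeneous
because the degree-0 part of u u⁻¹ = 1 reads u π(u⁻¹) = 1, with π the projection to degree -a. -/
theorem IsAssociativeTorus.exists_inv (h : IsAssociativeTorus 𝒜) {a : Λ} {x : A} (hx : x ∈ 𝒜 a)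
    (hx0 : x ≠ 0) : ∃ y ∈ 𝒜 (-a), x * y = 1 ∧ y * x = 1 := by
  have hn := h.nontrivial
  have hne : 𝒜 a ≠ ⊥ := fun hb => hx0 (by simpa [hb] using hx)
  obtain ⟨w, hw, hu⟩ := h.exists_isUnit a hne
  obtain ⟨t, rfl⟩ := h.eq_smul hw hu.ne_zero hx
  have ht : t ≠ 0 := by rintro rfl; simp at hx0
  obtain ⟨u, rfl⟩ := hu
  obtain ⟨π, h1, h2, h3, h4⟩ := exists_homogeneous_proj 𝒜 h.indep h.iSup_eq_top
  have : (π 0) ∘ₗ (LinearMap.mulLeft F (u : A)) = (LinearMap.mulLeft F (u : A)) ∘ₗ (π (-a)) := by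
    refine linearMap_ext_of_iSup_eq_top 𝒜 h.iSup_eq_top fun c y hy => ?_
    have hm := h.mul_mem _ _ _ hw y hy
    by_cases hc : c = -a
    · subst hc
      simp [h2 _ y hy, h2 0 (u * y) (by simpa using hm)]
    · simp [h3 (-a) c hc y hy, h3 0 (a + c) (fun h0 => hc (eq_neg_of_add_eq_zero_right h0)) _ hm]
  have h5 := LinearMap.congr_fun this (u⁻¹ : Aˣ)
  simp only [LinearMap.comp_apply, LinearMap.mulLeft_apply, Units.mul_inv, h2 0 1 h.one_mem] at h5
  have h6 : π (-a) (u⁻¹ : Aˣ) = (u⁻¹ : Aˣ) := by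
    have := congrArg (fun z => ((u⁻¹ : Aˣ) : A) * z) h5
    simpa using this.symm
  refine ⟨t⁻¹ • (u⁻¹ : Aˣ), Submodule.smul_mem _ _ (h6 ▸ h1 _ _), ?_, ?_⟩ <;>
    simp [smul_smul, ht]

/-- A trace form on an associative torus. -/
theorem IsAssociativeTorus.exists_trace (h : IsAssociativeTorus 𝒜) :
    ∃ ε : A →ₗ[F] F, ε 1 = 1 ∧ (∀ x y, ε (x * y) = ε (y * x)) ∧
      (∀ a, a ≠ 0 → ∀ x ∈ 𝒜 a, ε x = 0) ∧ ∀ x, (∀ y, ε (x * y) = 0) → x = 0 := by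
  have hn := h.nontrivial
  obtain ⟨π, h1, h2, h3, h4⟩ := exists_homogeneous_proj 𝒜 h.indep h.iSup_eq_top
  -- The degree-0 part of A is F · 1, so after `π 0` the choice of the retraction `e` onto the
  -- scalars is immaterial.
  obtain ⟨e, he⟩ := (LinearMap.toSpanSingleton F A 1).exists_leftInverse_of_injective
    (by rw [LinearMap.ker_toSpanSingleton F one_ne_zero])
  have he1 : e 1 = 1 := by
    simpa using LinearMap.congr_fun he 1
  have hoff : ∀ a, a ≠ 0 → ∀ x ∈ 𝒜 a, (e ∘ₗ π 0) x = 0 := fun a ha x hx => by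
    simp [h3 0 a ha x hx]
  have hone : (e ∘ₗ π 0) 1 = 1 := by simp [h2 0 1 h.one_mem, he1]
  refine ⟨e ∘ₗ π 0, hone, fun x y => ?_, hoff, fun x hx => ?_⟩
  · have : (LinearMap.mul F A).compr₂ (e ∘ₗ π 0) = (LinearMap.mul F A).flip.compr₂ (e ∘ₗ π 0) := by
      refine linearMap_ext_of_iSup_eq_top 𝒜 h.iSup_eq_top fun a x hx => ?_
      refine linearMap_ext_of_iSup_eq_top 𝒜 h.iSup_eq_top fun b y hy => ?_
      simp only [LinearMap.compr₂_apply, LinearMap.flip_apply, LinearMap.mul_apply']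
      by_cases hab : a + b = 0
      -- In opposite degrees y is a multiple of the inverse of x, so x and y commute.
      · by_cases hx0 : x = 0
        · simp [hx0]
        obtain ⟨z, hz, hxz, hzx⟩ := h.exists_inv hx hx0
        have hz0 : z ≠ 0 := by rintro rfl; simp at hxz
        have hb : b = -a := eq_neg_of_add_eq_zero_right hab
        subst hb
        obtain ⟨t, rfl⟩ := h.eq_smul hz hz0 hy
        simp only [mul_smul_comm, smul_mul_assoc, hxz, hzx]
      · rw [hoff _ hab _ (h.mul_mem _ _ _ hx _ hy),
          hoff _ (by rwa [add_comm]) _ (h.mul_mem _ _ _ hy _ hx)]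
    simpa using LinearMap.congr_fun (LinearMap.congr_fun this x) y
  · refine h4 x fun a => ?_
    by_contra hne
    -- Multiplying x by the inverse of its degree-a component isolates that component: the form
    -- takes the value 1.
    obtain ⟨z, hz, hxz, hzx⟩ := h.exists_inv (h1 a x) hne
    have key : (e ∘ₗ π 0) ∘ₗ (LinearMap.mulRight F z) =
        (e ∘ₗ π 0) ∘ₗ (LinearMap.mulRight F z) ∘ₗ π a := by
      refine linearMap_ext_of_iSup_eq_top 𝒜 h.iSup_eq_top fun c y hy => ?_
      by_cases hc : c = a
      · subst hc
        simp [h2 _ y hy]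
      · have := hoff (c + -a) (fun h0 => hc (by rwa [← sub_eq_add_neg, sub_eq_zero] at h0)) _
          (h.mul_mem _ _ y hy z hz)
        simp only [LinearMap.comp_apply, LinearMap.mulRight_apply, h3 a c hc y hy, map_zero] at this ⊢
        exact this
    have := LinearMap.congr_fun key x
    have hx' := hx z
    simp only [LinearMap.comp_apply, LinearMap.mulRight_apply] at this hx' hone
    rw [hxz, hx', hone] at this
    exact zero_ne_one this

/-- A central sum of commutators in an associative torus vanishes. -/
theorem IsAssociativeTorus.eq_zero_of_central (h : IsAssociativeTorus 𝒜) {z : A}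
    (hz : ∀ x, z * x = x * z)
    (hc : z ∈ Submodule.span F (Set.range fun p : A × A => p.1 * p.2 - p.2 * p.1)) : z = 0 := by
  obtain ⟨ε, e1, e2, e3, e4⟩ := h.exists_trace
  obtain ⟨π, h1, h2, h3, h4⟩ := exists_homogeneous_proj 𝒜 h.indep h.iSup_eq_top
  refine h4 z fun a => ?_
  by_contra hne
  obtain ⟨w, hw, hzw, hwz⟩ := h.exists_inv (h1 a z) hne
  -- Homogeneous components of a central element are central: compare the parts of degree a + c in z
  -- y = y z for y of degree c.
  have hcomm : ∀ x, π a z * x = x * π a z := by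
    have : LinearMap.mulLeft F (π a z) = LinearMap.mulRight F (π a z) := by
      refine linearMap_ext_of_iSup_eq_top 𝒜 h.iSup_eq_top fun c y hy => ?_
      have k1 : π (a + c) ∘ₗ LinearMap.mulRight F y = LinearMap.mulRight F y ∘ₗ π a := by
        refine linearMap_ext_of_iSup_eq_top 𝒜 h.iSup_eq_top fun b x hx => ?_
        have hm := h.mul_mem _ _ x hx y hy
        by_cases hb : b = a
        · subst hb; simp [h2 _ x hx, h2 _ _ hm]
        · simp [h3 a b hb x hx, h3 (a + c) (b + c) (by simpa using hb) _ hm]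
      have k2 : π (a + c) ∘ₗ LinearMap.mulLeft F y = LinearMap.mulLeft F y ∘ₗ π a := by
        refine linearMap_ext_of_iSup_eq_top 𝒜 h.iSup_eq_top fun b x hx => ?_
        have hm := h.mul_mem _ _ y hy x hx
        by_cases hb : b = a
        · subst hb; simp [h2 _ x hx, h2 (b + c) _ (by rwa [add_comm] at hm)]
        · simp [h3 a b hb x hx, h3 (a + c) (c + b) (by rw [add_comm]; simpa using hb) _ hm]
      have k1' := LinearMap.congr_fun k1 z
      have k2' := LinearMap.congr_fun k2 z
      simp only [LinearMap.comp_apply, LinearMap.mulLeft_apply, LinearMap.mulRight_apply]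
        at k1' k2' ⊢
      rw [← k1', ← k2', hz]
    exact fun x => by simpa using LinearMap.congr_fun this x
  have hwc : ∀ x, w * x = x * w := fun x => by
    calc w * x = w * x * (π a z * w) := by rw [hzw, mul_one]
      _ = w * (x * π a z) * w := by noncomm_ring
      _ = (w * π a z) * (x * w) := by rw [← hcomm]; noncomm_ring
      _ = x * w := by rw [hwz, one_mul]
  -- As w is central, (xy - yx) w is again a commutator and ε kills it. But ε(z w) sees only the
  -- degree-a part of z, whose product with w is 1.
  have key : ε (z * w) = 0 := by
    have : ∀ y ∈ Submodule.span F (Set.range fun p : A × A => p.1 * p.2 - p.2 * p.1),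
        ε (y * w) = 0 := fun y hy => by
      induction hy using Submodule.span_induction with
      | mem x hx =>
        obtain ⟨⟨x, y⟩, rfl⟩ := hx
        rw [sub_mul, map_sub, mul_assoc, e2 x, mul_assoc, hwc, ← mul_assoc, sub_self]
      | zero => simp
      | add x y _ _ hx hy => rw [add_mul, map_add, hx, hy, add_zero]
      | smul c x _ hx => rw [smul_mul_assoc, map_smul, hx, smul_zero]
    exact this z hc
  have key2 : ε ∘ₗ (LinearMap.mulRight F w) =
        ε ∘ₗ (LinearMap.mulRight F w) ∘ₗ π a := by
    refine linearMap_ext_of_iSup_eq_top 𝒜 h.iSup_eq_top fun c y hy => ?_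
    by_cases hc : c = a
    · subst hc
      simp [h2 _ y hy]
    · have := e3 (c + -a) (fun h0 => hc (by rwa [← sub_eq_add_neg, sub_eq_zero] at h0)) _
        (h.mul_mem _ _ y hy w hw)
      simp [h3 a c hc y hy, this]
  have := LinearMap.congr_fun key2 z
  simp only [LinearMap.comp_apply, LinearMap.mulRight_apply] at this
  rw [key, hzw, e1] at this
  exact zero_ne_one this

end AssociativeTorus

/-! ### The Lie torus `sl_(l+1)(A)` -/

section SpecialLinearTorus

set_option linter.unusedSectionVars false

variable {F : Type*} [Field F] [CharZero F] {l : ℕ} {A : Type*} [Ring A] [Algebra F A]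
  {Λ : Type*} [AddCommGroup Λ] {𝒜 : Λ → Submodule F A}

theorem single_mem_slAlg {i j : Fin (l + 1)} (h : i ≠ j) (a : A) :
    Matrix.single i j a ∈ slAlg F l A := by
  have : (Matrix.single i j a : Matrix (Fin (l + 1)) (Fin (l + 1)) A) =
      ⁅Matrix.single i j a, Matrix.single j j (1 : A)⁆ := by
    rw [Ring.lie_def, Matrix.single_mul_single_same, mul_one,
      Matrix.single_mul_single_of_ne _ _ _ _ h.symm, sub_zero]
  rw [this]
  exact LieSubmodule.lie_mem_lie (LieSubmodule.mem_top _) (LieSubmodule.mem_top _)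

variable (F) in
/-- The matrix unit multiple `a E_ij`, `i ≠ j`, as an element of `sl_(l+1)(A)`. -/
def slSingle {i j : Fin (l + 1)} (h : i ≠ j) : A →ₗ[F] slAlg F l A where
  toFun a := ⟨Matrix.single i j a, single_mem_slAlg h a⟩
  map_add' a b := Subtype.ext (Matrix.single_add i j a b)
  map_smul' c a := Subtype.ext (Matrix.smul_single c i j a).symm

theorem slSingle_coe {i j : Fin (l + 1)} (h : i ≠ j) (a : A) :
    (slSingle F h a : Matrix (Fin (l + 1)) (Fin (l + 1)) A) = Matrix.single i j a := rfl

theorem slSingle_injective {i j : Fin (l + 1)} (h : i ≠ j) {a b : A}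
    (e : slSingle F h a = slSingle F h b) : a = b := by
  have := congrArg (fun x => x.1 i j) e
  simpa [slSingle_coe] using this

theorem slAlg_coe_lie (x y : slAlg F l A) : (⁅x, y⁆ : slAlg F l A).1 = x.1 * y.1 - y.1 * x.1 := rfl

theorem slSingle_lie {i j k : Fin (l + 1)} (hij : i ≠ j) (hjk : j ≠ k) (hik : i ≠ k) (a b : A) :
    ⁅slSingle F hij a, slSingle F hjk b⁆ = slSingle F hik (a * b) := by
  apply Subtype.ext
  rw [slAlg_coe_lie]
  simp only [slSingle_coe]
  rw [Matrix.single_mul_single_same, Matrix.single_mul_single_of_ne _ _ _ _ hik.symm, sub_zero]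

theorem slSingle_mem {i j : Fin (l + 1)} (h : i ≠ j) {a : A} {c : Λ} (ha : a ∈ 𝒜 c) :
    slSingle F h a ∈ slGrading F l 𝒜 (latticeDiff F i j) c := by
  refine ⟨fun r s hrs => ?_, fun r s => ?_⟩
  · rw [slSingle_coe, Matrix.single_apply] at hrs
    obtain ⟨⟨rfl, rfl⟩, -⟩ := ite_ne_right_iff.mp hrs
    rfl
  · rw [slSingle_coe, Matrix.single_apply]
    split_ifs
    exacts [ha, Submodule.zero_mem _]

theorem mem_slRootSpace_latticeDiff {i j : Fin (l + 1)} (h : i ≠ j) {x : slAlg F l A}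
    (hx : x ∈ slRootSpace F l A (latticeDiff F i j)) : x = slSingle F h (x.1 i j) := by
  apply Subtype.ext
  ext r s
  rw [slSingle_coe, Matrix.single_apply]
  split_ifs with hrs
  · obtain ⟨rfl, rfl⟩ := hrs; rfl
  · by_contra hne
    have := latticeDiff_inj (F := F) h (k := r) (m := s) (Subtype.ext (hx r s hne).symm)
    exact hrs ⟨this.1.symm, this.2.symm⟩

theorem slRootSpace_eq {q : (typeA F l).rootSpan ℤ} {x : slAlg F l A} (hx : x ∈ slRootSpace F l A q)
    {i j : Fin (l + 1)} (hij : x.1 i j ≠ 0) : latticeDiff F i j = q :=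
  Subtype.ext (hx i j hij)

/-- A matrix in `sl_(l+1)(A)` commuting with all `a E_ij` vanishes. -/
theorem IsAssociativeTorus.slAlg_eq_zero (h𝒜 : IsAssociativeTorus 𝒜) (hl : 1 ≤ l)
    {x : slAlg F l A}
    (hx : ∀ (i j : Fin (l + 1)) (h : i ≠ j) (a : A), ⁅x, slSingle F h a⁆ = 0) : x = 0 := by
  have key : ∀ (i j : Fin (l + 1)) (_ : i ≠ j) (a : A),
      x.1 * Matrix.single i j a = Matrix.single i j a * x.1 := fun i j h a => by
    have := congrArg Subtype.val (hx i j h a)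
    rw [slAlg_coe_lie, slSingle_coe] at this
    exact sub_eq_zero.mp this
  have hne : ∀ i : Fin (l + 1), ∃ j, j ≠ i := fun i => by
    have : Nontrivial (Fin (l + 1)) := Fin.nontrivial_iff_two_le.mpr (by omega)
    exact exists_ne i
  have hoff : ∀ r i, r ≠ i → x.1 r i = 0 := fun r i hri => by
    obtain ⟨j, hj⟩ := hne i
    have := congrFun (congrFun (key i j hj.symm 1) r) j
    rw [Matrix.mul_single_apply_same, Matrix.single_mul_apply_of_ne _ _ _ _ _ hri, mul_one] at this
    exact this
  have hdiag : ∀ i j, i ≠ j → ∀ a, x.1 i i * a = a * x.1 j j := fun i j hij a => by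
    have := congrFun (congrFun (key i j hij a) i) j
    rwa [Matrix.mul_single_apply_same, Matrix.single_mul_apply_same] at this
  have heq : ∀ i, x.1 i i = x.1 0 0 := fun i => by
    by_cases hi : i = 0
    · rw [hi]
    · simpa using hdiag i 0 hi 1
  have hcen : ∀ a, x.1 0 0 * a = a * x.1 0 0 := fun a => by
    obtain ⟨j, hj⟩ := hne 0
    rw [hdiag 0 j hj.symm a, heq j]
  -- At this point x = z · 1 with z central, so its trace is (l + 1) z. Traces of elements of sl are
  -- sums of commutators, and dividing by l + 1 puts z itself among them.
  have htr : ∀ y ∈ slAlg F l A, Matrix.trace y ∈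
      Submodule.span F (Set.range fun p : A × A => p.1 * p.2 - p.2 * p.1) := fun y hy => by
    rw [← LieSubmodule.mem_toSubmodule, LieSubmodule.lieIdeal_oper_eq_linear_span'] at hy
    induction hy using Submodule.span_induction with
    | mem w hw =>
      obtain ⟨y, -, z, -, rfl⟩ := hw
      have : Matrix.trace ⁅y, z⁆ = ∑ i, ∑ j, (y i j * z j i - z j i * y i j) := by
        rw [Ring.lie_def, Matrix.trace_sub]
        simp only [Matrix.trace, Matrix.diag, Matrix.mul_apply, Finset.sum_sub_distrib]
        congr 1
        rw [Finset.sum_comm]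
      rw [this]
      exact Submodule.sum_mem _ fun i _ => Submodule.sum_mem _ fun j _ =>
        Submodule.subset_span ⟨(y i j, z j i), rfl⟩
    | zero => simp
    | add u v _ _ hu hv => rw [Matrix.trace_add]; exact Submodule.add_mem _ hu hv
    | smul c u _ hu => rw [Matrix.trace_smul]; exact Submodule.smul_mem _ c hu
  have htx := htr x.1 x.2
  have hsum : Matrix.trace x.1 = ((l + 1 : ℕ) : F) • x.1 0 0 := by
    simp only [Matrix.trace, Matrix.diag]
    rw [Finset.sum_congr rfl fun i _ => heq i]
    rw [Nat.cast_smul_eq_nsmul, Finset.sum_const, Finset.card_univ, Fintype.card_fin]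
  rw [hsum] at htx
  have hz : x.1 0 0 ∈ Submodule.span F (Set.range fun p : A × A => p.1 * p.2 - p.2 * p.1) := by
    have := Submodule.smul_mem _ (((l + 1 : ℕ) : F)⁻¹) htx
    rwa [smul_smul, inv_mul_cancel₀ (Nat.cast_ne_zero.mpr (Nat.succ_ne_zero l)), one_smul] at this
  have hz0 := h𝒜.eq_zero_of_central hcen hz
  apply Subtype.ext
  ext r s
  by_cases hrs : r = s
  · subst hrs; rw [heq, hz0]; rfl
  · exact hoff r s hrs

theorem IsAssociativeTorus.center_slAlg (h𝒜 : IsAssociativeTorus 𝒜) (hl : 1 ≤ l) :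
    LieAlgebra.center F (slAlg F l A) = ⊥ := by
  rw [eq_bot_iff]
  intro x hx
  rw [LieModule.mem_maxTrivSubmodule] at hx
  rw [LieSubmodule.mem_bot]
  refine h𝒜.slAlg_eq_zero hl fun i j h a => ?_
  rw [← lie_skew, hx, neg_zero]

/-- `sl_(l+1)(A)` is spanned by the elements `a E_ij` and `ab E_ii - ba E_jj` for homogeneous
`a` and `b`. -/
theorem IsAssociativeTorus.slAlg_le (h𝒜 : IsAssociativeTorus 𝒜)
    (S : Submodule F (Matrix (Fin (l + 1)) (Fin (l + 1)) A))
    (h1 : ∀ i j, i ≠ j → ∀ c, ∀ a ∈ 𝒜 c, Matrix.single i j a ∈ S)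
    (h2 : ∀ i j, ∀ c d, ∀ a ∈ 𝒜 c, ∀ b ∈ 𝒜 d,
      Matrix.single i i (a * b) - Matrix.single j j (b * a) ∈ S) {x} (hx : x ∈ slAlg F l A) :
    x ∈ S := by
  have hS : ∀ (i j k m : Fin (l + 1)) (a b : A),
      ⁅Matrix.single i j a, Matrix.single k m b⁆ ∈ S := by
    intro i j k m a b
    have ha : a ∈ ⨆ c, 𝒜 c := by rw [h𝒜.iSup_eq_top]; trivial
    have hb : b ∈ ⨆ c, 𝒜 c := by rw [h𝒜.iSup_eq_top]; trivial
    induction ha using Submodule.iSup_induction' with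
    | zero => simp
    | add x y _ _ hx hy => rw [Matrix.single_add, add_lie]; exact S.add_mem hx hy
    | mem c a ha =>
    induction hb using Submodule.iSup_induction' with
    | zero => simp
    | add x y _ _ hx hy => rw [Matrix.single_add, lie_add]; exact S.add_mem hx hy
    | mem d b hb =>
    rw [Ring.lie_def]
    by_cases hjk : j = k
    · subst hjk
      rw [Matrix.single_mul_single_same]
      by_cases him : i = m
      · subst him
        rw [Matrix.single_mul_single_same]
        exact h2 i j c d a ha b hb
      · rw [Matrix.single_mul_single_of_ne _ _ _ _ (Ne.symm him), sub_zero]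
        exact h1 i m him _ _ (h𝒜.mul_mem _ _ _ ha _ hb)
    · rw [Matrix.single_mul_single_of_ne _ _ _ _ hjk, zero_sub]
      by_cases him : m = i
      · subst him
        rw [Matrix.single_mul_single_same]
        exact S.neg_mem (h1 k j (Ne.symm hjk) _ _ (h𝒜.mul_mem _ _ _ hb _ ha))
      · rw [Matrix.single_mul_single_of_ne _ _ _ _ him, neg_zero]
        exact S.zero_mem
  rw [← LieSubmodule.mem_toSubmodule, LieSubmodule.lieIdeal_oper_eq_linear_span'] at hx
  refine Submodule.span_le.mpr ?_ hx
  rintro _ ⟨y, -, z, -, rfl⟩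
  rw [Matrix.matrix_eq_sum_single y, Matrix.matrix_eq_sum_single z]
  simp only [sum_lie, lie_sum]
  exact S.sum_mem fun _ _ => S.sum_mem fun _ _ => S.sum_mem fun _ _ => S.sum_mem fun _ _ =>
    hS _ _ _ _ _ _

theorem IsAssociativeTorus.isBigraded (h𝒜 : IsAssociativeTorus 𝒜) :
    IsBigradedLieAlgebra (typeA F l) (slGrading F l 𝒜) where
  indep := by
    classical
    rw [iSupIndep_iff_finsetSum_eq_zero_imp_eq_zero]
    intro s v hv h0 x hx
    apply Subtype.ext
    ext i j
    by_contra hne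
    have hne' : (v x).1 i j ≠ 0 := hne
    have hq := slRootSpace_eq (hv x hx).1 hne'
    -- A nonzero entry at (i, j) determines the root degree, so only summands of the root degree of
    -- x contribute. Those have distinct degrees in Λ, and independence of `𝒜` applies to their
    -- entries.
    have hs : ∑ y ∈ s.filter (fun y => y.1 = x.1), (v y).1 i j = 0 := by
      have h1 : ∑ y ∈ s, (v y).1 i j = 0 := by
        have := congrArg (fun w : slAlg F l A => w.1 i j) h0
        simpa [Matrix.sum_apply] using this
      rw [← h1]
      refine Finset.sum_filter_of_ne fun y hy hy0 => ?_
      rw [← slRootSpace_eq (hv y hy).1 hy0, hq]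
    have h2 : ∑ c ∈ (s.filter (fun y => y.1 = x.1)).image Prod.snd, (v (x.1, c)).1 i j = 0 := by
      rw [Finset.sum_image]
      · rw [← hs]
        refine Finset.sum_congr rfl fun y hy => ?_
        rw [← (Finset.mem_filter.mp hy).2]
      · rintro ⟨a, b⟩ ha ⟨c, d⟩ hc e
        have e1 := (Finset.mem_filter.mp ha).2
        have e2 := (Finset.mem_filter.mp hc).2
        simp only at e1 e2 e
        rw [e1, e2, e]
    have h3 := (iSupIndep_iff_finsetSum_eq_zero_imp_eq_zero 𝒜).mp h𝒜.indep _ _ (fun c hc => by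
      obtain ⟨y, hy, rfl⟩ := Finset.mem_image.mp hc
      obtain ⟨hy, e⟩ := Finset.mem_filter.mp hy
      rw [← e]
      exact (hv y hy).2 i j) h2 x.2
      (Finset.mem_image.mpr ⟨x, Finset.mem_filter.mpr ⟨hx, rfl⟩, rfl⟩)
    exact hne' h3
  iSup_eq_top := by
    rw [eq_top_iff]
    rintro x -
    set T : Submodule F (slAlg F l A) :=
      ⨆ x : (typeA F l).rootSpan ℤ × Λ, slGrading F l 𝒜 x.1 x.2 with hT
    have hle : ∀ q c, slGrading F l 𝒜 q c ≤ T := fun q c =>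
      le_iSup (fun x : (typeA F l).rootSpan ℤ × Λ => slGrading F l 𝒜 x.1 x.2) (q, c)
    have := h𝒜.slAlg_le (T.map (slAlg F l A).toSubmodule.subtype)
      (fun i j hij c a ha => ⟨slSingle F hij a, hle _ _ (slSingle_mem hij ha), rfl⟩)
      (fun i j c d a ha b hb => by
        have hmem : Matrix.single i i (a * b) - Matrix.single j j (b * a) ∈ slAlg F l A := by
          have : (Matrix.single i i (a * b) - Matrix.single j j (b * a) :
              Matrix (Fin (l + 1)) (Fin (l + 1)) A) =
              ⁅Matrix.single i j a, Matrix.single j i b⁆ := by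
            rw [Ring.lie_def, Matrix.single_mul_single_same, Matrix.single_mul_single_same]
          rw [this]
          exact LieSubmodule.lie_mem_lie (LieSubmodule.mem_top _) (LieSubmodule.mem_top _)
        refine ⟨⟨_, hmem⟩, hle 0 (c + d) ⟨fun r s hrs => ?_, fun r s => ?_⟩, rfl⟩
        · have : r = s := by
            by_contra h
            apply hrs
            change (Matrix.single i i (a * b) - Matrix.single j j (b * a) : Matrix _ _ A) r s = 0
            rw [Matrix.sub_apply, Matrix.single_apply_of_ne, Matrix.single_apply_of_ne, sub_zero]
            · rintro ⟨rfl, rfl⟩; exact h rfl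
            · rintro ⟨rfl, rfl⟩; exact h rfl
          subst this
          ext; simp [typeADiff]
        · refine (𝒜 (c + d)).sub_mem ?_ ?_
          · rw [Matrix.single_apply]
            split_ifs
            exacts [h𝒜.mul_mem _ _ _ ha _ hb, Submodule.zero_mem _]
          · rw [Matrix.single_apply]
            split_ifs
            exacts [add_comm c d ▸ h𝒜.mul_mem _ _ _ hb _ ha, Submodule.zero_mem _])
      x.2
    obtain ⟨y, hy, hyx⟩ := this
    exact (Subtype.ext hyx : y = x) ▸ hy
  lie_mem := by
    intro p q a b x hx y hy
    refine ⟨fun i k hik => ?_, fun i k => ?_⟩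
    · have : latticeDiff F i k = p + q := by
        by_contra hne
        apply hik
        rw [slAlg_coe_lie, Matrix.sub_apply, Matrix.mul_apply, Matrix.mul_apply,
          Finset.sum_eq_zero, Finset.sum_eq_zero, sub_zero]
        · intro j _
          by_contra h0
          have h1 := slRootSpace_eq hy.1 (left_ne_zero_of_mul h0)
          have h2 := slRootSpace_eq hx.1 (right_ne_zero_of_mul h0)
          exact hne (by rw [add_comm p q, ← h1, ← h2, latticeDiff_add])
        · intro j _
          by_contra h0
          have h1 := slRootSpace_eq hx.1 (left_ne_zero_of_mul h0)
          have h2 := slRootSpace_eq hy.1 (right_ne_zero_of_mul h0)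
          exact hne (by rw [← h1, ← h2, latticeDiff_add])
      exact congrArg Subtype.val this
    · rw [slAlg_coe_lie, Matrix.sub_apply, Matrix.mul_apply, Matrix.mul_apply]
      exact Submodule.sub_mem _
        (Submodule.sum_mem _ fun j _ => h𝒜.mul_mem _ _ _ (hx.2 i j) _ (hy.2 j k))
        (Submodule.sum_mem _ fun j _ => add_comm a b ▸ h𝒜.mul_mem _ _ _ (hy.2 i j) _ (hx.2 j k))

theorem IsAssociativeTorus.generated_slAlg (h𝒜 : IsAssociativeTorus 𝒜) (hl : 1 ≤ l)
    {S : LieSubalgebra F (slAlg F l A)}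
    (h1 : ∀ i j (h : i ≠ j) c, ∀ a ∈ 𝒜 c, slSingle F h a ∈ S) : S = ⊤ := by
  rw [eq_top_iff]
  rintro x -
  have hall : ∀ i j (h : i ≠ j) (a : A), slSingle F h a ∈ S := fun i j h a => by
    have ha : a ∈ ⨆ c, 𝒜 c := by rw [h𝒜.iSup_eq_top]; trivial
    have : ⨆ c, 𝒜 c ≤ S.toSubmodule.comap (slSingle F h) := iSup_le fun c a ha => h1 i j h c a ha
    exact this ha
  have hd : ∀ i j, i ≠ j → ∀ a b : A, Matrix.single i i (a * b) - Matrix.single j j (b * a) ∈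
      S.toSubmodule.map (slAlg F l A).toSubmodule.subtype := fun i j hij a b => by
    refine ⟨⁅slSingle F hij a, slSingle F hij.symm b⁆, S.lie_mem (hall i j hij a)
      (hall j i hij.symm b), ?_⟩
    change (⁅slSingle F hij a, slSingle F hij.symm b⁆ : slAlg F l A).1 = _
    rw [slAlg_coe_lie, slSingle_coe, slSingle_coe, Matrix.single_mul_single_same,
      Matrix.single_mul_single_same]
  have := h𝒜.slAlg_le (S.toSubmodule.map (slAlg F l A).toSubmodule.subtype)
    (fun i j hij c a ha => ⟨slSingle F hij a, hall i j hij a, rfl⟩)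
    (fun i j c d a ha b hb => by
      by_cases hij : i = j
      · subst hij
        have : Nontrivial (Fin (l + 1)) := Fin.nontrivial_iff_two_le.mpr (by omega)
        obtain ⟨k, hk⟩ := exists_ne i
        have e1 := hd i k hk.symm a b
        -- A commutator on a single diagonal place is split through another index k: (ab E_ii - ba
        -- E_kk) + (ba E_kk - ba E_ii).
        have e2 := hd k i hk (b * a) 1
        have := Submodule.add_mem _ e1 e2
        simpa using this
      · exact hd i j hij a b) x.2
  obtain ⟨y, hy, hyx⟩ := this
  exact (Subtype.ext hyx : y = x) ▸ hy

theorem diagonal_commutator_apply (c : Fin (l + 1) → F) (y : Matrix (Fin (l + 1)) (Fin (l + 1)) A)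
    (r s : Fin (l + 1)) :
    (Matrix.diagonal (fun k => algebraMap F A (c k)) * y -
      y * Matrix.diagonal (fun k => algebraMap F A (c k))) r s = (c r - c s) • y r s := by
  rw [Matrix.sub_apply, Matrix.diagonal_mul, Matrix.mul_diagonal, ← Algebra.smul_def,
    ← Algebra.commutes, ← Algebra.smul_def, sub_smul]

theorem slSingle_lie_diagonal {i j : Fin (l + 1)} (hij : i ≠ j) {v w : A} (hvw : v * w = 1)
    (hwv : w * v = 1) : (⁅slSingle F hij v, slSingle F hij.symm w⁆ : slAlg F l A).1 =
      Matrix.diagonal (fun k => algebraMap F A ((if k = i then 1 else 0) - if k = j then 1 else 0)) := by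
  rw [slAlg_coe_lie, slSingle_coe, slSingle_coe, Matrix.single_mul_single_same,
      Matrix.single_mul_single_same, hvw, hwv]
  ext r s
  rw [Matrix.sub_apply, Matrix.single_apply, Matrix.single_apply, Matrix.diagonal_apply]
  by_cases hrs : r = s
  · subst hrs
    simp only [and_self, eq_comm (a := i), eq_comm (a := j), if_true, map_sub]
    split_ifs <;> simp
  · rw [if_neg hrs, if_neg (by rintro ⟨rfl, rfl⟩; exact hrs rfl),
      if_neg (by rintro ⟨rfl, rfl⟩; exact hrs rfl), sub_zero]

theorem slSingle_sl2_lie {i j : Fin (l + 1)} (hij : i ≠ j) {v w : A} (hvw : v * w = 1)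
    (hwv : w * v = 1) (τ : (typeA F l).rootSpan ℤ) {y : slAlg F l A}
    (hy : y ∈ slRootSpace F l A τ) :
    ⁅⁅slSingle F hij v, slSingle F hij.symm w⁆, y⁆ =
      ((τ : typeASpace F l).1 i - (τ : typeASpace F l).1 j) • y := by
  apply Subtype.ext
  ext r s
  change _ = ((τ : typeASpace F l).1 i - (τ : typeASpace F l).1 j) • y.1 r s
  rw [slAlg_coe_lie, slSingle_lie_diagonal hij hvw hwv, diagonal_commutator_apply]
  by_cases h0 : y.1 r s = 0
  · rw [h0, smul_zero, smul_zero]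
  · rw [← slRootSpace_eq hy h0, latticeDiff_coe_apply, latticeDiff_coe_apply]
    simp only [eq_comm (a := i), eq_comm (a := j)]
    congr 1
    ring

theorem IsAssociativeTorus.slGrading_eq_span (h𝒜 : IsAssociativeTorus 𝒜) {i j : Fin (l + 1)}
    (hij : i ≠ j) {c : Λ} {v : A} (hv : v ∈ 𝒜 c) (hv0 : v ≠ 0) :
    slGrading F l 𝒜 (latticeDiff F i j) c = F ∙ slSingle F hij v := by
  refine le_antisymm (fun y hy => ?_) ?_
  · obtain ⟨t, ht⟩ := h𝒜.eq_smul hv hv0 (hy.2 i j)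
    rw [mem_slRootSpace_latticeDiff hij hy.1, ht, map_smul]
    exact Submodule.smul_mem _ _ (Submodule.mem_span_singleton_self _)
  · rw [Submodule.span_singleton_le_iff_mem]
    exact slSingle_mem hij hv

theorem iSup_slGrading_le (τ : (typeA F l).rootSpan ℤ) :
    (⨆ b, slGrading F l 𝒜 τ b) ≤ slRootSpace F l A τ :=
  iSup_le fun _ => inf_le_left

theorem exists_eq_latticeDiff_of_slGrading_ne_bot {q : (typeA F l).rootSpan ℤ}
    (hq : (⨆ a, slGrading F l 𝒜 q a) ≠ ⊥) : ∃ i j, latticeDiff F i j = q := by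
  have : ∃ a, slGrading F l 𝒜 q a ≠ ⊥ := by
    by_contra! h
    exact hq (iSup_eq_bot.mpr h)
  obtain ⟨a, ha⟩ := this
  obtain ⟨x, hx, hx0⟩ := Submodule.exists_mem_ne_zero_of_ne_bot ha
  have : ∃ i j, x.1 i j ≠ 0 := by
    by_contra! h
    exact hx0 (Subtype.ext (Matrix.ext h))
  obtain ⟨i, j, hij⟩ := this
  exact ⟨i, j, slRootSpace_eq hx.1 hij⟩

theorem IsAssociativeTorus.exists_slGrading_sl2 (h𝒜 : IsAssociativeTorus 𝒜) {i j : Fin (l + 1)}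
    (hij : i ≠ j) {a : Λ} (ha : slGrading F l 𝒜 (latticeDiff F i j) a ≠ ⊥) :
    ∃ e f : slAlg F l A, slGrading F l 𝒜 (latticeDiff F i j) a = F ∙ e ∧
      slGrading F l 𝒜 (-latticeDiff F i j) (-a) = F ∙ f ∧
      ∀ τ : (typeA F l).rootSpan ℤ, ∀ x ∈ ⨆ b, slGrading F l 𝒜 τ b,
        ⁅⁅e, f⁆, x⁆ = ((τ : typeASpace F l).1 i - (τ : typeASpace F l).1 j) • x := by
  obtain ⟨x, hx, hx0⟩ := Submodule.exists_mem_ne_zero_of_ne_bot ha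
  have hxs := mem_slRootSpace_latticeDiff hij hx.1
  have hx1 := hx.2 i j
  have hx2 : x.1 i j ≠ 0 := fun h0 => hx0 (by rw [hxs, h0, map_zero])
  obtain ⟨w, hw, hvw, hwv⟩ := h𝒜.exists_inv hx1 hx2
  have hn := h𝒜.nontrivial
  have hw0 : w ≠ 0 := by rintro rfl; simp at hvw
  refine ⟨slSingle F hij (x.1 i j), slSingle F hij.symm w, h𝒜.slGrading_eq_span hij hx1 hx2, ?_,
    fun τ y hy => ?_⟩
  · rw [latticeDiff_neg]
    exact h𝒜.slGrading_eq_span hij.symm hw hw0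
  · exact slSingle_sl2_lie hij hvw hwv τ (iSup_slGrading_le τ hy)

theorem slGrading_ne_bot {i j : Fin (l + 1)} (hij : i ≠ j) {a : Λ} (ha : 𝒜 a ≠ ⊥) :
    slGrading F l 𝒜 (latticeDiff F i j) a ≠ ⊥ := by
  obtain ⟨x, hx, hx0⟩ := Submodule.exists_mem_ne_zero_of_ne_bot ha
  intro hb
  have h := slSingle_mem (F := F) hij hx
  rw [hb, Submodule.mem_bot, ← map_zero (slSingle F hij)] at h
  exact hx0 (slSingle_injective hij h)

theorem iSup_slGrading_ne_bot (hl : 1 ≤ l) {a : Λ} (ha : 𝒜 a ≠ ⊥) :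
    (⨆ q, slGrading F l 𝒜 q a) ≠ ⊥ := by
  have : Nontrivial (Fin (l + 1)) := Fin.nontrivial_iff_two_le.mpr (by omega)
  obtain ⟨k, hk⟩ := exists_ne (0 : Fin (l + 1))
  intro hb
  exact slGrading_ne_bot (F := F) hk ha (iSup_eq_bot.mp hb _)

theorem IsAssociativeTorus.isLieTorus (h𝒜 : IsAssociativeTorus 𝒜) (hl : 1 ≤ l) :
    IsLieTorus (typeA F l) (slGrading F l 𝒜) where
  toIsBigradedLieAlgebra := h𝒜.isBigraded
  supp_subset := by
    intro q hq
    obtain ⟨i, j, rfl⟩ := exists_eq_latticeDiff_of_slGrading_ne_bot hq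
    by_cases h : i = j
    · subst h; exact Or.inl (latticeDiff_self i)
    · exact Or.inr ⟨⟨(i, j), h⟩, rfl⟩
  exists_sl2 := by
    rintro ⟨⟨i, j⟩, hij⟩ a ha
    obtain ⟨e, f, he, hf, hef⟩ := h𝒜.exists_slGrading_sl2 hij ha
    refine ⟨e, f, he, hf, fun τ x hx => ?_⟩
    rw [typeA_pairing]
    exact hef τ x hx
  indivisible_ne_bot := by
    rintro ⟨⟨i, j⟩, hij⟩ -
    have hn := h𝒜.nontrivial
    exact slGrading_ne_bot hij fun hb =>
      one_ne_zero ((Submodule.mem_bot F).mp (hb ▸ h𝒜.one_mem))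
  generated := by
    refine h𝒜.generated_slAlg hl fun i j h c a ha => ?_
    refine LieSubalgebra.subset_lieSpan (Set.mem_iUnion.mpr ⟨⟨(i, j), h⟩, ?_⟩)
    exact Submodule.mem_iSup_of_mem c (slSingle_mem h ha)
  closure_supp := by
    rw [eq_top_iff, ← h𝒜.closure_supp]
    exact AddSubgroup.closure_mono fun a (ha : 𝒜 a ≠ ⊥) => iSup_slGrading_ne_bot hl ha

/-- The form is ε(tr(xy)). Pairing with a E_ji shows that an element of the radical has no
off-diagonal entries. By invariance [x, a E_ij] is in the radical along with x, so it has none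
either; being a bracket of a diagonal matrix with an off-diagonal unit it vanishes, and
`slAlg_eq_zero` applies. -/
theorem IsAssociativeTorus.exists_form (h𝒜 : IsAssociativeTorus 𝒜) (hl : 1 ≤ l) :
    ∃ B : slAlg F l A →ₗ[F] slAlg F l A →ₗ[F] F,
    (∀ x y, B x y = B y x) ∧
    (∀ x y z, B ⁅x, y⁆ z = B x ⁅y, z⁆) ∧
    (∀ x, (∀ y, B x y = 0) → x = 0) ∧
    ∀ (p q : (typeA F l).rootSpan ℤ) (a b : Λ), a + b ≠ 0 ∨ p + q ≠ 0 →
      ∀ x ∈ slGrading F l 𝒜 p a, ∀ y ∈ slGrading F l 𝒜 q b, B x y = 0 := by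
  obtain ⟨ε, e1, e2, e3, e4⟩ := h𝒜.exists_trace
  set ι : slAlg F l A →ₗ[F] Matrix (Fin (l + 1)) (Fin (l + 1)) A :=
    (slAlg F l A).toSubmodule.subtype
  set t : Matrix (Fin (l + 1)) (Fin (l + 1)) A →ₗ[F] F :=
    ε ∘ₗ Matrix.traceLinearMap (Fin (l + 1)) F A with ht
  have htcomm : ∀ x y, t (x * y) = t (y * x) := fun x y => by
    simp only [ht, LinearMap.comp_apply, Matrix.traceLinearMap_apply, Matrix.trace, Matrix.diag,
      Matrix.mul_apply, map_sum]
    rw [Finset.sum_comm]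
    simp only [e2]
  set B : slAlg F l A →ₗ[F] slAlg F l A →ₗ[F] F :=
    ((LinearMap.mul F (Matrix (Fin (l + 1)) (Fin (l + 1)) A)).compr₂ t).compl₁₂ ι ι
  have hB : ∀ x y, B x y = t (x.1 * y.1) := fun _ _ => rfl
  have hinv : ∀ x y z, B ⁅x, y⁆ z = B x ⁅y, z⁆ := fun x y z => by
    simp only [hB, slAlg_coe_lie, sub_mul, mul_sub, map_sub]
    rw [mul_assoc, mul_assoc, htcomm y.1, mul_assoc]
  refine ⟨B, fun x y => htcomm _ _, hinv, fun x hx => ?_, fun p q a b hpq x hx y hy => ?_⟩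
  · have hoff : ∀ x : slAlg F l A, (∀ y, B x y = 0) → ∀ i j, i ≠ j → x.1 i j = 0 := by
      intro x hx i j hij
      refine e4 _ fun a => ?_
      have := hx (slSingle F hij.symm a)
      rw [hB, slSingle_coe] at this
      simpa [ht, Matrix.trace_mul_single] using this
    refine h𝒜.slAlg_eq_zero hl fun i j hij a => ?_
    apply Subtype.ext
    ext r s
    by_cases hrs : r = s
    · subst hrs
      rw [slAlg_coe_lie, slSingle_coe, Matrix.sub_apply, Matrix.mul_apply, Matrix.mul_apply,
        Finset.sum_eq_zero, Finset.sum_eq_zero, sub_zero]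
      · rfl
      · intro k _
        rw [Matrix.single_apply]
        split_ifs with h
        · obtain ⟨rfl, rfl⟩ := h
          rw [hoff x hx _ _ hij.symm, mul_zero]
        · rw [zero_mul]
      · intro k _
        rw [Matrix.single_apply]
        split_ifs with h
        · obtain ⟨rfl, rfl⟩ := h
          rw [hoff x hx _ _ hij.symm, zero_mul]
        · rw [mul_zero]
    · exact hoff _ (fun y => by rw [hinv, hx]) r s hrs
  · rw [hB]
    simp only [ht, LinearMap.comp_apply, Matrix.traceLinearMap_apply, Matrix.trace, Matrix.diag,
      Matrix.mul_apply, map_sum]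
    refine Finset.sum_eq_zero fun i _ => Finset.sum_eq_zero fun j _ => ?_
    rcases hpq with hab | hpq
    · exact e3 _ hab _ (h𝒜.mul_mem _ _ _ (hx.2 i j) _ (hy.2 j i))
    · by_contra h0
      have h1 : x.1 i j * y.1 j i ≠ 0 := fun h => h0 (by rw [h, map_zero])
      apply hpq
      rw [← slRootSpace_eq hx.1 (left_ne_zero_of_mul h1),
        ← slRootSpace_eq hy.1 (right_ne_zero_of_mul h1), latticeDiff_add, latticeDiff_self]

end SpecialLinearTorus

/-! ### Root components and matrix units in a Lie torus of type `A_l` -/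

section RootComponents

set_option linter.unusedSectionVars false

variable {F : Type*} [Field F] [CharZero F] {l : ℕ} {Λ : Type*} [AddCommGroup Λ]
  {L : Type*} [LieRing L] [LieAlgebra F L] {𝓛 : (typeA F l).rootSpan ℤ → Λ → Submodule F L}

variable (𝓛) in
/-- The component `L_(ε_i - ε_j)` of the grading by the root lattice. -/
def rootComp (i j : Fin (l + 1)) : Submodule F L := ⨆ a, 𝓛 (latticeDiff F i j) a

theorem mem_rootComp {i j : Fin (l + 1)} {a : Λ} {x : L} (hx : x ∈ 𝓛 (latticeDiff F i j) a) :
    x ∈ rootComp 𝓛 i j := Submodule.mem_iSup_of_mem a hx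

theorem IsBigradedLieAlgebra.lie_mem_iSup (h : IsBigradedLieAlgebra (typeA F l) 𝓛)
    {p q : (typeA F l).rootSpan ℤ} {x y : L} (hx : x ∈ ⨆ a, 𝓛 p a) (hy : y ∈ ⨆ a, 𝓛 q a) :
    ⁅x, y⁆ ∈ ⨆ a, 𝓛 (p + q) a := by
  induction hx using Submodule.iSup_induction' with
  | zero => simp
  | add x x' _ _ hx hx' => rw [add_lie]; exact Submodule.add_mem _ hx hx'
  | mem a x hx =>
  induction hy using Submodule.iSup_induction' with
  | zero => simp
  | add x x' _ _ hx hx' => rw [lie_add]; exact Submodule.add_mem _ hx hx'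
  | mem b y hy => exact Submodule.mem_iSup_of_mem (a + b) (h.lie_mem p q a b x hx y hy)

theorem IsBigradedLieAlgebra.lie_mem_rootComp (h : IsBigradedLieAlgebra (typeA F l) 𝓛)
    {i j k : Fin (l + 1)} {x y : L} (hx : x ∈ rootComp 𝓛 i j) (hy : y ∈ rootComp 𝓛 j k) :
    ⁅x, y⁆ ∈ rootComp 𝓛 i k := by
  have := h.lie_mem_iSup hx hy
  rwa [latticeDiff_add] at this

theorem IsBigradedLieAlgebra.lie_mem_latticeDiff (h : IsBigradedLieAlgebra (typeA F l) 𝓛)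
    {i j k : Fin (l + 1)} {a b : Λ} {x y : L} (hx : x ∈ 𝓛 (latticeDiff F i j) a)
    (hy : y ∈ 𝓛 (latticeDiff F j k) b) : ⁅x, y⁆ ∈ 𝓛 (latticeDiff F i k) (a + b) := by
  have := h.lie_mem _ _ _ _ _ hx _ hy
  rwa [latticeDiff_add] at this

theorem IsLieTorus.iSup_eq_bot (h : IsLieTorus (typeA F l) 𝓛) {q : (typeA F l).rootSpan ℤ}
    (hq : ∀ i j, q ≠ latticeDiff F i j) : ⨆ a, 𝓛 q a = ⊥ := by
  by_contra hne
  rcases h.supp_subset q hne with h0 | ⟨⟨⟨i, j⟩, hij⟩, hp⟩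
  · exact hq 0 0 (by rw [h0, latticeDiff_self])
  · exact hq i j (Subtype.ext hp.symm)

theorem IsLieTorus.eq_bot (h : IsLieTorus (typeA F l) 𝓛) {q : (typeA F l).rootSpan ℤ}
    (hq : ∀ i j, q ≠ latticeDiff F i j) (a : Λ) : 𝓛 q a = ⊥ :=
  _root_.iSup_eq_bot.mp (h.iSup_eq_bot hq) a

theorem IsLieTorus.lie_eq_zero (h : IsLieTorus (typeA F l) 𝓛) {i j k m : Fin (l + 1)}
    (h1 : i ≠ j) (h2 : i ≠ m) (h3 : k ≠ j) (h4 : k ≠ m) {x y : L} (hx : x ∈ rootComp 𝓛 i j)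
    (hy : y ∈ rootComp 𝓛 k m) : ⁅x, y⁆ = 0 := by
  have := h.lie_mem_iSup hx hy
  rwa [h.iSup_eq_bot (latticeDiff_add_latticeDiff_ne h1 h2 h3 h4), Submodule.mem_bot] at this

/-- The defect in the Jacobi identity is [y,[x,z]], and [x,z] = 0 since the two roots do not sum to
a root or 0. The middle element y is arbitrary. -/
theorem IsLieTorus.lie_assoc (h : IsLieTorus (typeA F l) 𝓛) {i j k m : Fin (l + 1)}
    (h1 : i ≠ j) (h2 : i ≠ m) (h3 : k ≠ j) (h4 : k ≠ m) {x z : L} (hx : x ∈ rootComp 𝓛 i j)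
    (hz : z ∈ rootComp 𝓛 k m) (y : L) : ⁅⁅x, y⁆, z⁆ = ⁅x, ⁅y, z⁆⁆ := by
  rw [lie_lie, h.lie_eq_zero h1 h2 h3 h4 hx hz, lie_zero, sub_zero]

/-- The centralizer of x is a subalgebra containing the generating root components, so x is central.
-/
theorem IsLieTorus.eq_zero_of_lie_rootComp (h : IsLieTorus (typeA F l) 𝓛)
    (hZ : LieAlgebra.center F L = ⊥) {x : L}
    (hx : ∀ i j : Fin (l + 1), i ≠ j → ∀ y ∈ rootComp 𝓛 i j, ⁅x, y⁆ = 0) : x = 0 := by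
  have hall : ∀ y : L, ⁅x, y⁆ = 0 := fun y => by
    have hy : y ∈ LieSubalgebra.lieSpan F L
      (⋃ i : TypeAIndex l, ((⨆ a, 𝓛 ((typeA F l).rootSpanMem ℤ i) a : Submodule F L) : Set L)) := by
      rw [h.generated]; trivial
    induction hy using LieSubalgebra.lieSpan_induction with
    | mem y hy =>
      obtain ⟨⟨⟨i, j⟩, hij⟩, hy⟩ := Set.mem_iUnion.mp hy
      exact hx i j hij y hy
    | zero => simp
    | smul c y _ hy => rw [lie_smul, hy, smul_zero]
    | add y z _ _ hy hz => rw [lie_add, hy, hz, add_zero]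
    | lie y z _ _ hy hz => rw [leibniz_lie, hy, hz, zero_lie, lie_zero, add_zero]
  have : x ∈ LieAlgebra.center F L := by
    rw [LieModule.mem_maxTrivSubmodule]
    intro y
    rw [← lie_skew, hall, neg_zero]
  rwa [hZ, LieSubmodule.mem_bot] at this

/-- A system of matrix units in degree zero. -/
structure IsMatrixUnits (𝓛 : (typeA F l).rootSpan ℤ → Λ → Submodule F L)
    (u : Fin (l + 1) → Fin (l + 1) → L) : Prop where
  mem : ∀ {i j}, i ≠ j → u i j ∈ 𝓛 (latticeDiff F i j) 0
  lie : ∀ {i j k}, i ≠ j → j ≠ k → i ≠ k → ⁅u i j, u j k⁆ = u i k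
  weight : ∀ {i j}, i ≠ j → ∀ {r s} {x : L}, x ∈ rootComp 𝓛 r s →
    ⁅⁅u i j, u j i⁆, x⁆ = (((if i = r then 1 else 0) - (if i = s then 1 else 0)) -
      ((if j = r then 1 else 0) - (if j = s then 1 else 0)) : F) • x

theorem IsLieTorus.exists_sl2_latticeDiff (h : IsLieTorus (typeA F l) 𝓛) {i j : Fin (l + 1)}
    (hij : i ≠ j) {a : Λ} (ha : 𝓛 (latticeDiff F i j) a ≠ ⊥) :
    ∃ e f : L, 𝓛 (latticeDiff F i j) a = F ∙ e ∧ 𝓛 (latticeDiff F j i) (-a) = F ∙ f ∧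
      ∀ {r s} {x : L}, x ∈ rootComp 𝓛 r s →
        ⁅⁅e, f⁆, x⁆ = (((if i = r then 1 else 0) - (if i = s then 1 else 0)) -
      ((if j = r then 1 else 0) - (if j = s then 1 else 0)) : F) • x := by
  obtain ⟨e, f, he, hf, hef⟩ := h.exists_sl2 ⟨(i, j), hij⟩ a ha
  refine ⟨e, f, he, ?_, fun {r s x} hx => ?_⟩
  · rw [← latticeDiff_neg]
    exact hf
  · rw [hef _ x hx, typeA_pairing, latticeDiff_coe_apply, latticeDiff_coe_apply]

/-- Every root of type A_l is indivisible: its i-th coordinate is 1, whereas twice a root has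
coordinates 0, 2, -2. -/
theorem IsLieTorus.ne_bot (h : IsLieTorus (typeA F l) 𝓛) {i j : Fin (l + 1)} (hij : i ≠ j) :
    𝓛 (latticeDiff F i j) 0 ≠ ⊥ := by
  refine h.indivisible_ne_bot ⟨(i, j), hij⟩ ?_
  rintro ⟨⟨k, m⟩, hkm⟩ e
  have key : ∀ n, (if n = i then (1 : F) else 0) - (if n = j then 1 else 0) =
      2 * ((if n = k then 1 else 0) - (if n = m then 1 else 0)) := fun n => by
    have h1 := congrArg (fun v : typeASpace F l => v.1 n) e
    have h2 : ((2 : ℤ) • typeADiff F l k m : typeASpace F l).1 n =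
        2 * (typeADiff F l k m).1 n := by
      rw [two_smul, two_mul]; rfl
    have h3 : (typeADiff F l i j).1 n = 2 * (typeADiff F l k m).1 n := h1.trans h2
    simpa [typeADiff, Pi.single_apply] using h3
  have h2 : (2 : F) ≠ 0 := two_ne_zero
  have h1 := key i
  grind

/-- Independently chosen sl₂-pairs need not be compatible, so choices are made only along the star
of index 0: E_0j = e_j, E_j0 = f_j, and then E_ij = [f_i, e_j] is forced. The relations follow from
`lie_assoc` and the weights of [e_j, f_j], which acts as E_00 - E_jj. -/
theorem IsLieTorus.exists_matrixUnits (h : IsLieTorus (typeA F l) 𝓛) :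
    ∃ u, IsMatrixUnits 𝓛 u := by
  have hex : ∀ j : Fin (l + 1), ∃ e f : L, 0 ≠ j → e ∈ 𝓛 (latticeDiff F 0 j) 0 ∧
      f ∈ 𝓛 (latticeDiff F j 0) 0 ∧ ∀ {r s} {x : L}, x ∈ rootComp 𝓛 r s →
        ⁅⁅e, f⁆, x⁆ = (((if 0 = r then 1 else 0) - (if 0 = s then 1 else 0)) -
      ((if j = r then 1 else 0) - (if j = s then 1 else 0)) : F) • x := fun j => by
    by_cases hj : 0 = j
    · exact ⟨0, 0, fun h => absurd hj h⟩
    · obtain ⟨e, f, he, hf, hef⟩ := h.exists_sl2_latticeDiff hj (h.ne_bot hj)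
      refine ⟨e, f, fun _ => ⟨?_, ?_, hef⟩⟩
      · rw [he]; exact Submodule.mem_span_singleton_self e
      · rw [neg_zero] at hf
        rw [hf]; exact Submodule.mem_span_singleton_self f
  choose e f hef using hex
  have he : ∀ {j}, 0 ≠ j → e j ∈ 𝓛 (latticeDiff F 0 j) 0 := fun hj => (hef _ hj).1
  have hf : ∀ {j}, 0 ≠ j → f j ∈ 𝓛 (latticeDiff F j 0) 0 := fun hj => (hef _ hj).2.1
  have he' : ∀ {j}, 0 ≠ j → e j ∈ rootComp 𝓛 0 j := fun hj => mem_rootComp (he hj)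
  have hf' : ∀ {j}, 0 ≠ j → f j ∈ rootComp 𝓛 j 0 := fun hj => mem_rootComp (hf hj)
  have hw : ∀ {j}, 0 ≠ j → ∀ {r s} {x : L}, x ∈ rootComp 𝓛 r s →
        ⁅⁅e j, f j⁆, x⁆ = (((if 0 = r then 1 else 0) - (if 0 = s then 1 else 0)) -
      ((if j = r then 1 else 0) - (if j = s then 1 else 0)) : F) • x := fun hj => (hef _ hj).2.2
  have hg : ∀ {i j}, 0 ≠ i → 0 ≠ j → ⁅f i, e j⁆ ∈ 𝓛 (latticeDiff F i j) 0 := fun hi hj => by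
    simpa using h.lie_mem_latticeDiff (hf hi) (he hj)
  have hg' : ∀ {i j}, 0 ≠ i → 0 ≠ j → ⁅f i, e j⁆ ∈ rootComp 𝓛 i j :=
    fun hi hj => mem_rootComp (hg hi hj)
  have k1 : ∀ {i j}, 0 ≠ i → 0 ≠ j → i ≠ j → ⁅⁅f i, e j⁆, f j⁆ = f i := fun {i j} hi hj hij => by
    rw [h.lie_assoc hi.symm hi.symm hj.symm hj.symm (hf' hi) (hf' hj), ← lie_skew,
      hw hj (hf' hi)]
    simp [hi, hij.symm, hj.symm]
  have k2 : ∀ {i j}, 0 ≠ i → 0 ≠ j → i ≠ j → ⁅e j, ⁅f j, e i⁆⁆ = e i := fun {i j} hi hj hij => by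
    rw [← h.lie_assoc hj hi hj hi (he' hj) (he' hi), hw hj (he' hi)]
    simp [hi, hij.symm, hj.symm]
  have k3 : ∀ {i j k}, 0 ≠ i → 0 ≠ j → 0 ≠ k → i ≠ j → j ≠ k → i ≠ k →
      ⁅⁅f i, e j⁆, ⁅f j, e k⁆⁆ = ⁅f i, e k⁆ := fun {i j k} hi hj hk hij hjk hik => by
    rw [← h.lie_assoc hij hik hj hk (hg' hi hj) (he' hk), k1 hi hj hij]
  have k4 : ∀ {i j}, 0 ≠ i → 0 ≠ j → i ≠ j →
      ⁅⁅f i, e j⁆, ⁅f j, e i⁆⁆ = ⁅e j, f j⁆ - ⁅e i, f i⁆ := fun {i j} hi hj hij => by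
    rw [lie_lie, k2 hi hj hij, ← lie_skew, ← lie_skew (f i) ⁅f j, e i⁆, k1 hj hi hij.symm,
      lie_neg, neg_sub_neg]
  set u : Fin (l + 1) → Fin (l + 1) → L := fun i j =>
    if i = 0 then e j else if j = 0 then f i else ⁅f i, e j⁆ with hu
  have u0 : ∀ j, u 0 j = e j := fun j => by simp [hu]
  have u1 : ∀ {i}, 0 ≠ i → u i 0 = f i := fun hi => by simp [hu, hi.symm]
  have u2 : ∀ {i j}, 0 ≠ i → 0 ≠ j → u i j = ⁅f i, e j⁆ := fun hi hj => by
    simp [hu, hi.symm, hj.symm]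
  refine ⟨u, fun {i j} hij => ?_, fun {i j k} hij hjk hik => ?_, fun {i j} hij {r s x} hx => ?_⟩
  · by_cases hi : 0 = i
    · subst hi; rw [u0]; exact he hij
    by_cases hj : 0 = j
    · subst hj; rw [u1 hi]; exact hf hi
    rw [u2 hi hj]; exact hg hi hj
  · by_cases hi : 0 = i
    · subst hi; rw [u0, u0, u2 hij hik, k2 hik hij hjk.symm]
    by_cases hj : 0 = j
    · subst hj; rw [u1 hi, u0, u2 hi hjk]
    by_cases hk : 0 = k
    · subst hk; rw [u2 hi hj, u1 hj, u1 hi, k1 hi hj hij]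
    rw [u2 hi hj, u2 hj hk, u2 hi hk, k3 hi hj hk hij hjk hik]
  · by_cases hi : 0 = i
    · subst hi; rw [u0, u1 hij, hw hij hx]
    by_cases hj : 0 = j
    · subst hj
      rw [u0, u1 hi, ← lie_skew (f i), neg_lie, hw hi hx, ← neg_smul, neg_sub]
    rw [u2 hi hj, u2 hj hi, k4 hi hj hij, sub_lie, hw hi hx, hw hj hx, ← sub_smul]
    congr 1
    ring

end RootComponents

/-! ### The coordinate algebra -/

section Coordinates

set_option linter.unusedSectionVars false

variable {F : Type*} [Field F] [CharZero F] {l : ℕ} {Λ : Type*} [AddCommGroup Λ]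
  {L : Type*} [LieRing L] [LieAlgebra F L] {𝓛 : (typeA F l).rootSpan ℤ → Λ → Submodule F L}
  {u : Fin (l + 1) → Fin (l + 1) → L}

/-- There are at least four indices. When fewer need avoiding, an argument is repeated. -/
theorem exists_ne₃ (hl : 3 ≤ l) (i j k : Fin (l + 1)) : ∃ m, m ≠ i ∧ m ≠ j ∧ m ≠ k := by
  by_contra! hc
  have hsub : (Finset.univ : Finset (Fin (l + 1))) ⊆ {i, j, k} := fun m _ => by
    have := hc m
    simp only [Finset.mem_insert, Finset.mem_singleton]
    tauto
  have := (Finset.card_le_card hsub).trans Finset.card_le_three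
  simp at this
  omega

theorem IsMatrixUnits.mem_rootComp (hu : IsMatrixUnits 𝓛 u) {i j : Fin (l + 1)} (hij : i ≠ j) :
    u i j ∈ rootComp 𝓛 i j := _root_.mem_rootComp (hu.mem hij)

/-- By `lie_assoc` the left side is [x, [u_jk, u_kj]], and x has weight -1 for [u_jk, u_kj]. Thus
right multiplications by u_jk and u_kj are mutually inverse between root components. -/
theorem IsMatrixUnits.lie_lie_right (hu : IsMatrixUnits 𝓛 u) (h : IsLieTorus (typeA F l) 𝓛)
    {i j k : Fin (l + 1)} (hij : i ≠ j) (hjk : j ≠ k) (hik : i ≠ k) {x : L}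
    (hx : x ∈ rootComp 𝓛 i j) : ⁅⁅x, u j k⁆, u k j⁆ = x := by
  rw [h.lie_assoc hij hij hjk.symm hjk.symm hx (hu.mem_rootComp hjk.symm), ← lie_skew,
    hu.weight hjk hx]
  simp [hij.symm, hik.symm, hjk.symm]

theorem IsMatrixUnits.lie_lie_left (hu : IsMatrixUnits 𝓛 u) (h : IsLieTorus (typeA F l) 𝓛)
    {i j k : Fin (l + 1)} (hij : i ≠ j) (hjk : j ≠ k) (hik : i ≠ k) {x : L}
    (hx : x ∈ rootComp 𝓛 i j) : ⁅u i k, ⁅u k i, x⁆⁆ = x := by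
  rw [← h.lie_assoc hik hij hik hij (hu.mem_rootComp hik) hx, hu.weight hik hx]
  simp [hij, hik.symm, hjk.symm]

variable (𝓛 u) in
/-- The coordinate space: compatible families of elements of the root components, which play the
role of the elements `a E_ij` for fixed `a`. -/
def coordSpace : Submodule F (Fin (l + 1) → Fin (l + 1) → L) where
  -- Diagonal members carry no information; they are set to 0 so that families are determined off
  -- the diagonal.
  carrier := {a | (∀ i, a i i = 0) ∧ (∀ i j, i ≠ j → a i j ∈ rootComp 𝓛 i j) ∧
    (∀ i j k, i ≠ j → j ≠ k → i ≠ k → ⁅a i j, u j k⁆ = a i k) ∧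
    ∀ i j k, i ≠ j → j ≠ k → i ≠ k → ⁅u k i, a i j⁆ = a k j}
  add_mem' := by
    rintro a b ⟨a1, a2, a3, a4⟩ ⟨b1, b2, b3, b4⟩
    refine ⟨fun i => ?_, fun i j hij => ?_, fun i j k hij hjk hik => ?_,
      fun i j k hij hjk hik => ?_⟩
    · simp [a1, b1]
    · exact Submodule.add_mem _ (a2 i j hij) (b2 i j hij)
    · simp [a3 i j k hij hjk hik, b3 i j k hij hjk hik]
    · simp [a4 i j k hij hjk hik, b4 i j k hij hjk hik]
  zero_mem' := by simp
  smul_mem' := by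
    rintro c a ⟨a1, a2, a3, a4⟩
    refine ⟨fun i => ?_, fun i j hij => ?_, fun i j k hij hjk hik => ?_,
      fun i j k hij hjk hik => ?_⟩
    · simp [a1]
    · exact Submodule.smul_mem _ c (a2 i j hij)
    · simp [a3 i j k hij hjk hik]
    · simp [a4 i j k hij hjk hik]

theorem coordSpace.ext {a b : coordSpace 𝓛 u} (h : ∀ i j, i ≠ j → a.1 i j = b.1 i j) : a = b := by
  apply Subtype.ext
  funext i j
  by_cases hij : i = j
  · subst hij; rw [a.2.1, b.2.1]
  · exact h i j hij

/-- A condition on one member of a coordinate family which is stable under bracketing with the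
matrix units holds for all members. -/
theorem coordSpace.propagate (hl : 3 ≤ l) (S : Fin (l + 1) → Fin (l + 1) → Submodule F L)
    (hR : ∀ i j k, i ≠ j → j ≠ k → i ≠ k → ∀ x ∈ S i j, ⁅x, u j k⁆ ∈ S i k)
    (hL : ∀ i j k, i ≠ j → j ≠ k → i ≠ k → ∀ x ∈ S i j, ⁅u k i, x⁆ ∈ S k j)
    (a : coordSpace 𝓛 u) {p q : Fin (l + 1)} (hpq : p ≠ q) (ha : a.1 p q ∈ S p q)
    {i j : Fin (l + 1)} (hij : i ≠ j) : a.1 i j ∈ S i j := by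
  have h1 : ∀ j, p ≠ j → a.1 p j ∈ S p j := fun j hj => by
    by_cases hq : q = j
    · subst hq; exact ha
    · rw [← a.2.2.2.1 p q j hpq hq hj]; exact hR p q j hpq hq hj _ ha
  have h2 : ∀ i j, i ≠ p → i ≠ j → p ≠ j → a.1 i j ∈ S i j := fun i j hi hij hj => by
    rw [← a.2.2.2.2 p j i hj hij.symm hi.symm]; exact hL p j i hj hij.symm hi.symm _ (h1 j hj)
  by_cases hi : i = p
  · subst hi; exact h1 j hij
  by_cases hj : p = j
  · subst hj
    obtain ⟨k, hk1, hk2, -⟩ := exists_ne₃ hl i p p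
    rw [← a.2.2.2.1 i k p hk1.symm hk2 hi]
    exact hR i k p hk1.symm hk2 hi _ (h2 i k hi hk1.symm hk2.symm)
  · exact h2 i j hi hij hj

/-- Propagation of the zero subspaces, applied to the difference. Identities between families may
therefore be checked at one position. -/
theorem coordSpace.eq_of_apply_eq (hl : 3 ≤ l) {a b : coordSpace 𝓛 u} {p q : Fin (l + 1)}
    (hpq : p ≠ q) (hab : a.1 p q = b.1 p q) : a = b := by
  rw [← sub_eq_zero]
  refine coordSpace.ext fun i j hij => ?_
  have := coordSpace.propagate hl (fun _ _ => ⊥) (by simp) (by simp) (a - b) hpq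
    (by simp [hab]) hij
  simpa using this

theorem coordSpace.mem_of_mem (hu : IsMatrixUnits 𝓛 u) (h : IsLieTorus (typeA F l) 𝓛)
    (hl : 3 ≤ l) {a : coordSpace 𝓛 u} {p q : Fin (l + 1)} (hpq : p ≠ q) {c : Λ}
    (ha : a.1 p q ∈ 𝓛 (latticeDiff F p q) c) {i j : Fin (l + 1)} (hij : i ≠ j) :
    a.1 i j ∈ 𝓛 (latticeDiff F i j) c :=
  coordSpace.propagate hl (fun i j => 𝓛 (latticeDiff F i j) c)
    (fun i j k _ hjk _ x hx => by simpa using h.lie_mem_latticeDiff hx (hu.mem hjk))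
    (fun i j k _ _ hik x hx => by simpa using h.lie_mem_latticeDiff (hu.mem hik.symm) hx)
    a hpq ha hij

/-- Every element of a root component extends to a coordinate family. -/
theorem coordSpace.exists_apply_eq (hu : IsMatrixUnits 𝓛 u) (h : IsLieTorus (typeA F l) 𝓛)
    (hl : 3 ≤ l) {p q : Fin (l + 1)} (hpq : p ≠ q) {x : L} (hx : x ∈ rootComp 𝓛 p q) :
    ∃ a : coordSpace 𝓛 u, a.1 p q = x := by
  have lr : ∀ {i j k m : Fin (l + 1)} (y : L), i ≠ j → i ≠ m → k ≠ j → k ≠ m →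
      ⁅⁅u i j, y⁆, u k m⁆ = ⁅u i j, ⁅y, u k m⁆⁆ := fun y h1 h2 h3 h4 =>
    h.lie_assoc h1 h2 h3 h4 (hu.mem_rootComp h1) (hu.mem_rootComp h4) y
  have xr : ∀ {i j k m : Fin (l + 1)} {x : L}, x ∈ rootComp 𝓛 i j → i ≠ j → j ≠ k → i ≠ k →
      i ≠ m → m ≠ j → k ≠ m → ⁅⁅x, u j k⁆, u k m⁆ = ⁅x, u j m⁆ := fun hx h1 h2 h3 h4 h5 h6 => by
    rw [h.lie_assoc h1 h4 h2.symm h6 hx (hu.mem_rootComp h6), hu.lie h2 h6 h5.symm]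
  have xl : ∀ {i j k m : Fin (l + 1)} {x : L}, x ∈ rootComp 𝓛 i j → i ≠ j → j ≠ k → i ≠ k →
      i ≠ m → m ≠ j → k ≠ m → ⁅u m k, ⁅u k i, x⁆⁆ = ⁅u m i, x⁆ := fun hx h1 h2 h3 h4 h5 h6 => by
    rw [← h.lie_assoc h6.symm h5 h3 h1 (hu.mem_rootComp h6.symm) hx, hu.lie h6.symm h3.symm h4.symm]
  -- Row p is forced by right multiplication of x by u_qj.
  obtain ⟨b, hb⟩ : ∃ b : Fin (l + 1) → L, b = fun j => if j = q then x else ⁅x, u q j⁆ := ⟨_, rfl⟩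
  have bq : b q = x := by simp [hb]
  have bj : ∀ {j}, j ≠ q → b j = ⁅x, u q j⁆ := fun hj => by simp [hb, hj]
  clear hb
  have bmem : ∀ {j}, p ≠ j → b j ∈ rootComp 𝓛 p j := fun {j} hj => by
    by_cases hjq : j = q
    · subst hjq; rwa [bq]
    · rw [bj hjq]
      exact h.lie_mem_rootComp hx (hu.mem_rootComp (Ne.symm hjq))
  have bR : ∀ {j k}, p ≠ j → p ≠ k → j ≠ k → ⁅b j, u j k⁆ = b k := fun {j k} hj hk hjk => by
    by_cases hjq : j = q
    · subst hjq; rw [bq, bj hjk.symm]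
    by_cases hkq : k = q
    · subst hkq; rw [bq, bj hjk, hu.lie_lie_right h hpq hjk.symm hj hx]
    rw [bj hjq, bj hkq, xr hx hpq (Ne.symm hjq) hj hk hkq hjk]
  -- Positions avoiding p altogether are forced by left multiplication of row p.
  obtain ⟨c, hc⟩ : ∃ c : Fin (l + 1) → Fin (l + 1) → L, ∀ i j, c i j = ⁅u i p, b j⁆ :=
    ⟨_, fun _ _ => rfl⟩
  have cmem : ∀ {i j}, p ≠ i → p ≠ j → i ≠ j → c i j ∈ rootComp 𝓛 i j := fun {i j} hi hj hij => by
    rw [hc]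
    exact h.lie_mem_rootComp (hu.mem_rootComp hi.symm) (bmem hj)
  have cR : ∀ {i j k}, p ≠ i → p ≠ j → p ≠ k → i ≠ j → j ≠ k → i ≠ k → ⁅c i j, u j k⁆ = c i k :=
    fun {i j k} hi hj hk hij hjk hik => by
    rw [hc, hc, lr _ hi.symm hik hj.symm hjk, bR hj hk hjk]
  have cL : ∀ {i j k}, p ≠ i → p ≠ j → p ≠ k → i ≠ j → j ≠ k → i ≠ k → ⁅u k i, c i j⁆ = c k j :=
    fun {i j k} hi hj hk hij hjk hik => by
    rw [hc, hc, xl (bmem hj) hj hij.symm hi hk hjk.symm hik]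
  have c0 : ∀ {i j}, p ≠ i → p ≠ j → i ≠ j → ⁅u p i, c i j⁆ = b j := fun {i j} hi hj hij => by
    rw [hc, hu.lie_lie_left h hj hij.symm hi (bmem hj)]
  -- Column p is not reached from row p in this way, since row p has no member at (p, p). It is
  -- entered from a position (i, κ i) instead; `cd` shows that the choice of κ i does not matter.
  choose κ κ1 κ2 _ using fun i => exists_ne₃ hl i p p
  obtain ⟨d, hd⟩ : ∃ d : Fin (l + 1) → L, ∀ i, d i = ⁅c i (κ i), u (κ i) p⁆ := ⟨_, fun _ => rfl⟩
  have cd : ∀ {i k}, p ≠ i → p ≠ k → i ≠ k → ⁅c i k, u k p⁆ = d i := fun {i k} hi hk hik => by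
    rw [hd]
    by_cases hkk : κ i = k
    · rw [hkk]
    · rw [← cR hi (κ2 i).symm hk (κ1 i).symm hkk hik,
        xr (cmem hi (κ2 i).symm (κ1 i).symm) (κ1 i).symm hkk hik hi.symm (κ2 i).symm hk.symm]
  have dmem : ∀ {i}, p ≠ i → d i ∈ rootComp 𝓛 i p := fun {i} hi => by
    rw [hd]
    exact h.lie_mem_rootComp (cmem hi (κ2 i).symm (κ1 i).symm) (hu.mem_rootComp (κ2 i))
  have dR : ∀ {i j}, p ≠ i → p ≠ j → i ≠ j → ⁅d i, u p j⁆ = c i j := fun {i j} hi hj hij => by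
    rw [← cd hi hj hij, hu.lie_lie_right h hij hj.symm hi.symm (cmem hi hj hij)]
  have dL : ∀ {i k}, p ≠ i → p ≠ k → i ≠ k → ⁅u k i, d i⁆ = d k := fun {i k} hi hk hik => by
    -- Left multiplication within column p passes through an auxiliary column m, so four distinct
    -- indices are needed.
    obtain ⟨m, hm1, hm2, hm3⟩ := exists_ne₃ hl i k p
    rw [← cd hi hm3.symm hm1.symm, ← lr _ hik.symm hk.symm hm1 hm3,
      cL hi hm3.symm hk hm1.symm hm2 hik, cd hk hm3.symm hm2.symm]
  obtain ⟨a, ha⟩ : ∃ a : Fin (l + 1) → Fin (l + 1) → L, a = fun i j =>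
    if i = j then 0 else if p = i then b j else if p = j then d i else c i j := ⟨_, rfl⟩
  have a0 : ∀ i, a i i = 0 := fun i => by simp [ha]
  have a1 : ∀ {j}, p ≠ j → a p j = b j := fun hj => by simp [ha, hj]
  have a2 : ∀ {i}, p ≠ i → a i p = d i := fun hi => by simp [ha, hi, hi.symm]
  have a3 : ∀ {i j}, p ≠ i → p ≠ j → i ≠ j → a i j = c i j := fun hi hj hij => by
    simp [ha, hi, hj, hij]
  clear ha
  refine ⟨⟨a, a0, fun i j hij => ?_, fun i j k hij hjk hik => ?_, fun i j k hij hjk hik => ?_⟩, ?_⟩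
  · by_cases hi : p = i
    · subst hi; rw [a1 hij]; exact bmem hij
    by_cases hj : p = j
    · subst hj; rw [a2 hi]; exact dmem hi
    rw [a3 hi hj hij]; exact cmem hi hj hij
  · by_cases hi : p = i
    · subst hi; rw [a1 hij, a1 hik, bR hij hik hjk]
    by_cases hj : p = j
    · subst hj; rw [a2 hi, a3 hi hjk hik, dR hi hjk hik]
    by_cases hk : p = k
    · subst hk; rw [a3 hi hj hij, a2 hi, cd hi hj hij]
    rw [a3 hi hj hij, a3 hi hk hik, cR hi hj hk hij hjk hik]
  · by_cases hj : p = j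
    · subst hj; rw [a2 hij.symm, a2 hjk, dL hij.symm hjk hik]
    by_cases hi : p = i
    · subst hi; rw [a1 hij, a3 hik hj hjk.symm, hc]
    by_cases hk : p = k
    · subst hk; rw [a3 hi hj hij, a1 hj, c0 hi hj hij]
    rw [a3 hi hj hij, a3 hk hj hjk.symm, cL hi hj hk hij hjk hik]
  · change a p q = x
    rw [a1 hpq, bq]

end Coordinates

/-! ### The associative torus structure on the coordinate space -/

section CoordinateAlgebra

set_option linter.unusedSectionVars false

variable {F : Type*} [Field F] [CharZero F] {l : ℕ} {Λ : Type*} [AddCommGroup Λ]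
  {L : Type*} [LieRing L] [LieAlgebra F L] {𝓛 : (typeA F l).rootSpan ℤ → Λ → Submodule F L}
  {u : Fin (l + 1) → Fin (l + 1) → L}

/-- Write a_ij = [a_im, u_mj] and move u_mj across the bracket: [u_mj, b_jk] = b_mk. The product is
thus independent of the middle index. -/
theorem coordSpace.lie_eq_lie (h : IsLieTorus (typeA F l) 𝓛)
    (a b : coordSpace 𝓛 u) {i j k m : Fin (l + 1)} (hij : i ≠ j) (hjk : j ≠ k) (hik : i ≠ k)
    (hm : m ≠ i) (hm' : m ≠ k) : ⁅a.1 i j, b.1 j k⁆ = ⁅a.1 i m, b.1 m k⁆ := by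
  by_cases hmj : m = j
  · rw [hmj]
  rw [← a.2.2.2.1 i m j hm.symm hmj hij, h.lie_assoc hm.symm hik (Ne.symm hmj) hjk
    (a.2.2.1 i m hm.symm) (b.2.2.1 j k hjk), b.2.2.2.2 j k m hjk hm'.symm (Ne.symm hmj)]

theorem coordSpace.exists_mul (hu : IsMatrixUnits 𝓛 u) (h : IsLieTorus (typeA F l) 𝓛)
    (hl : 3 ≤ l) : ∃ μ : coordSpace 𝓛 u →ₗ[F] coordSpace 𝓛 u →ₗ[F] coordSpace 𝓛 u,
      ∀ a b i j k, i ≠ j → j ≠ k → i ≠ k → (μ a b).1 i k = ⁅a.1 i j, b.1 j k⁆ := by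
  choose κ κ1 κ2 _ using fun i k => exists_ne₃ hl i k k
  have key : ∀ (a b : coordSpace 𝓛 u), ∀ {i j k}, i ≠ j → j ≠ k → i ≠ k →
      ⁅a.1 i (κ i k), b.1 (κ i k) k⁆ = ⁅a.1 i j, b.1 j k⁆ := fun a b {i j k} hij hjk hik =>
    coordSpace.lie_eq_lie h a b (κ1 i k).symm (κ2 i k) hik hij.symm hjk
  have hmem : ∀ a b : coordSpace 𝓛 u,
      (fun i k => if i = k then 0 else ⁅a.1 i (κ i k), b.1 (κ i k) k⁆) ∈ coordSpace 𝓛 u := by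
    intro a b
    refine ⟨fun i => by simp, fun i k hik => ?_, fun i j k hij hjk hik => ?_,
      fun i j k hij hjk hik => ?_⟩
    · simp only [if_neg hik]
      exact h.lie_mem_rootComp (a.2.2.1 _ _ (κ1 i k).symm) (b.2.2.1 _ _ (κ2 i k))
    · simp only [if_neg hij, if_neg hik]
      -- A middle index avoiding all three lets the products at (i, j) and (i, k) be computed over
      -- the same m.
      obtain ⟨m, hm1, hm2, hm3⟩ := exists_ne₃ hl i j k
      rw [key a b hm1.symm hm2 hij, key a b hm1.symm hm3 hik,
        h.lie_assoc hm1.symm hik hm2.symm hjk (a.2.2.1 _ _ hm1.symm) (hu.mem_rootComp hjk),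
        b.2.2.2.1 _ _ _ hm2 hjk hm3]
    · simp only [if_neg hij, if_neg hjk.symm]
      obtain ⟨m, hm1, hm2, hm3⟩ := exists_ne₃ hl i j k
      rw [key a b hm1.symm hm2 hij, key a b hm3.symm hm2 hjk.symm,
        ← h.lie_assoc hik.symm hjk.symm hm1 hm2 (hu.mem_rootComp hik.symm) (b.2.2.1 _ _ hm2),
        a.2.2.2.2 _ _ _ hm1.symm hm3 hik]
  refine ⟨LinearMap.mk₂ F (fun a b => ⟨_, hmem a b⟩) ?_ ?_ ?_ ?_, ?_⟩
  · intro a b c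
    refine coordSpace.ext fun i j hij => ?_
    simp [hij]
  · intro t a b
    refine coordSpace.ext fun i j hij => ?_
    simp [hij]
  · intro a b c
    refine coordSpace.ext fun i j hij => ?_
    simp [hij]
  · intro t a b
    refine coordSpace.ext fun i j hij => ?_
    simp [hij]
  · intro a b i j k hij hjk hik
    simp only [LinearMap.mk₂_apply, if_neg hik]
    exact key a b hij hjk hik

/-- The multiplication of the coordinate algebra: `(a b) E_ik = [a E_ij, b E_jk]`. -/
noncomputable def coordMul (hu : IsMatrixUnits 𝓛 u) (h : IsLieTorus (typeA F l) 𝓛) (hl : 3 ≤ l) :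
    coordSpace 𝓛 u →ₗ[F] coordSpace 𝓛 u →ₗ[F] coordSpace 𝓛 u :=
  (coordSpace.exists_mul hu h hl).choose

theorem coordMul_apply (hu : IsMatrixUnits 𝓛 u) (h : IsLieTorus (typeA F l) 𝓛) (hl : 3 ≤ l)
    (a b : coordSpace 𝓛 u) {i j k : Fin (l + 1)} (hij : i ≠ j) (hjk : j ≠ k) (hik : i ≠ k) :
    (coordMul hu h hl a b).1 i k = ⁅a.1 i j, b.1 j k⁆ :=
  (coordSpace.exists_mul hu h hl).choose_spec a b i j k hij hjk hik

/-- With i, m, j, k distinct, both sides at (i, k) are iterated brackets of a_im, b_mj, c_jk, and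
the outer roots do not add up to a root or 0. -/
theorem coordMul_assoc (hu : IsMatrixUnits 𝓛 u) (h : IsLieTorus (typeA F l) 𝓛) (hl : 3 ≤ l)
    (a b c : coordSpace 𝓛 u) : coordMul hu h hl (coordMul hu h hl a b) c =
      coordMul hu h hl a (coordMul hu h hl b c) := by
  refine coordSpace.ext fun i k hik => ?_
  obtain ⟨j, hj1, hj2, -⟩ := exists_ne₃ hl i k k
  obtain ⟨m, hm1, hm2, hm3⟩ := exists_ne₃ hl i k j
  rw [coordMul_apply hu h hl _ c hj1.symm hj2 hik, coordMul_apply hu h hl a b hm1.symm hm3 hj1.symm,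
    coordMul_apply hu h hl a _ hm1.symm hm2 hik, coordMul_apply hu h hl b c hm3 hj2 hm2,
    h.lie_assoc hm1.symm hik hm3.symm hj2 (a.2.2.1 _ _ hm1.symm) (c.2.2.1 _ _ hj2)]

/-- The unit of the coordinate algebra. -/
def coordOne (hu : IsMatrixUnits 𝓛 u) : coordSpace 𝓛 u :=
  ⟨fun i j => if i = j then 0 else u i j, fun i => by simp,
    fun i j hij => by simpa [hij] using hu.mem_rootComp hij,
    fun i j k hij hjk hik => by simp [hij, hik, hu.lie hij hjk hik],
    fun i j k hij hjk hik => by simp [hij, hjk.symm, hu.lie hik.symm hij hjk.symm]⟩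

theorem coordOne_apply (hu : IsMatrixUnits 𝓛 u) {i j : Fin (l + 1)} (hij : i ≠ j) :
    (coordOne hu).1 i j = u i j := if_neg hij

theorem coordOne_mul (hu : IsMatrixUnits 𝓛 u) (h : IsLieTorus (typeA F l) 𝓛) (hl : 3 ≤ l)
    (a : coordSpace 𝓛 u) : coordMul hu h hl (coordOne hu) a = a := by
  refine coordSpace.ext fun i k hik => ?_
  obtain ⟨j, hj1, hj2, -⟩ := exists_ne₃ hl i k k
  rw [coordMul_apply hu h hl _ a hj1.symm hj2 hik, coordOne_apply hu hj1.symm,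
    a.2.2.2.2 j k i hj2 hik.symm hj1]

theorem mul_coordOne (hu : IsMatrixUnits 𝓛 u) (h : IsLieTorus (typeA F l) 𝓛) (hl : 3 ≤ l)
    (a : coordSpace 𝓛 u) : coordMul hu h hl a (coordOne hu) = a := by
  refine coordSpace.ext fun i k hik => ?_
  obtain ⟨j, hj1, hj2, -⟩ := exists_ne₃ hl i k k
  rw [coordMul_apply hu h hl a _ hj1.symm hj2 hik, coordOne_apply hu hj2,
    a.2.2.2.1 i j k hj1.symm hj2 hik]

/-- The ring structure of the coordinate algebra. -/
@[reducible] noncomputable def coordRing (hu : IsMatrixUnits 𝓛 u) (h : IsLieTorus (typeA F l) 𝓛)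
    (hl : 3 ≤ l) : Ring (coordSpace 𝓛 u) :=
  { (inferInstance : AddCommGroup (coordSpace 𝓛 u)) with
    mul := fun a b => coordMul hu h hl a b
    one := coordOne hu
    left_distrib := fun a b c => map_add (coordMul hu h hl a) b c
    right_distrib := fun a b c => LinearMap.map_add₂ (coordMul hu h hl) a b c
    zero_mul := fun a => LinearMap.map_zero₂ (coordMul hu h hl) a
    mul_zero := fun a => map_zero (coordMul hu h hl a)
    mul_assoc := coordMul_assoc hu h hl
    one_mul := coordOne_mul hu h hl
    mul_one := mul_coordOne hu h hl }

/-- The algebra structure of the coordinate algebra. -/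
@[reducible] noncomputable def coordAlgebra (hu : IsMatrixUnits 𝓛 u)
    (h : IsLieTorus (typeA F l) 𝓛) (hl : 3 ≤ l) :
    letI := coordRing hu h hl
    Algebra F (coordSpace 𝓛 u) :=
  letI := coordRing hu h hl
  Algebra.ofModule (fun t a b => LinearMap.map_smul₂ (coordMul hu h hl) t a b)
    (fun t a b => map_smul (coordMul hu h hl a) t b)

variable (𝓛 u) in
/-- The grading of the coordinate algebra. -/
def coordGrading (c : Λ) : Submodule F (coordSpace 𝓛 u) where
  carrier := {a | ∀ i j, i ≠ j → a.1 i j ∈ 𝓛 (latticeDiff F i j) c}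
  add_mem' ha hb i j hij := Submodule.add_mem _ (ha i j hij) (hb i j hij)
  zero_mem' _ _ _ := Submodule.zero_mem _
  smul_mem' t _ ha i j hij := Submodule.smul_mem _ t (ha i j hij)

theorem coordSpace.exists_mem_apply_eq (hu : IsMatrixUnits 𝓛 u) (h : IsLieTorus (typeA F l) 𝓛)
    (hl : 3 ≤ l) {p q : Fin (l + 1)} (hpq : p ≠ q) {c : Λ} {x : L}
    (hx : x ∈ 𝓛 (latticeDiff F p q) c) : ∃ a ∈ coordGrading 𝓛 u c, a.1 p q = x := by
  obtain ⟨a, ha⟩ := coordSpace.exists_apply_eq hu h hl hpq (mem_rootComp hx)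
  exact ⟨a, fun i j hij => coordSpace.mem_of_mem hu h hl hpq (ha ▸ hx) hij, ha⟩

/-- Since b_jk = [b_ji, u_ik], the product at (i, k) is [[a_ij, b_ji], u_ik]. A statement about the
diagonal element [a_ij, b_ji], which the algebra does not see directly, thereby becomes one about
ab. -/
theorem coordMul_eq_one (hu : IsMatrixUnits 𝓛 u) (h : IsLieTorus (typeA F l) 𝓛) (hl : 3 ≤ l)
    {a b : coordSpace 𝓛 u} {i j : Fin (l + 1)} (hij : i ≠ j)
    (hw : ∀ k, k ≠ i → k ≠ j → ⁅⁅a.1 i j, b.1 j i⁆, u i k⁆ = u i k) :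
    coordMul hu h hl a b = coordOne hu := by
  obtain ⟨k, hk1, hk2, -⟩ := exists_ne₃ hl i j j
  refine coordSpace.eq_of_apply_eq hl hk1.symm ?_
  rw [coordMul_apply hu h hl a b hij hk2.symm hk1.symm, coordOne_apply hu hk1.symm,
    ← b.2.2.2.1 j i k hij.symm hk1.symm hk2.symm,
    ← h.lie_assoc hij hk1.symm hij hk1.symm (a.2.2.1 _ _ hij) (hu.mem_rootComp hk1.symm),
    hw k hk1 hk2]

/-- The families through the sl₂-pair e, f for the root ε_0 - ε_q are mutually inverse: [e, f] has
weight 1 on u_0k and [f, e] has weight 1 on u_qk. -/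
theorem exists_coordInv (hu : IsMatrixUnits 𝓛 u) (h : IsLieTorus (typeA F l) 𝓛) (hl : 3 ≤ l)
    {c : Λ} (hc : coordGrading 𝓛 u c ≠ ⊥) : ∃ a ∈ coordGrading 𝓛 u c, ∃ b,
      coordMul hu h hl a b = coordOne hu ∧ coordMul hu h hl b a = coordOne hu := by
  obtain ⟨v, hv, hv0⟩ := Submodule.exists_mem_ne_zero_of_ne_bot hc
  obtain ⟨q, hq, -, -⟩ := exists_ne₃ hl 0 0 0
  have hne : 𝓛 (latticeDiff F 0 q) c ≠ ⊥ := fun hb => hv0 <| by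
    refine coordSpace.eq_of_apply_eq hl hq.symm ?_
    have := hv 0 q hq.symm
    rw [hb, Submodule.mem_bot] at this
    rw [this]; rfl
  obtain ⟨e, f, he, hf, hw⟩ := h.exists_sl2_latticeDiff hq.symm hne
  have he' : e ∈ 𝓛 (latticeDiff F 0 q) c := he ▸ Submodule.mem_span_singleton_self e
  have hf' : f ∈ 𝓛 (latticeDiff F q 0) (-c) := hf ▸ Submodule.mem_span_singleton_self f
  obtain ⟨a, ha, hae⟩ := coordSpace.exists_mem_apply_eq hu h hl hq.symm he'
  obtain ⟨b, hb, hbf⟩ := coordSpace.exists_mem_apply_eq hu h hl hq hf'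
  refine ⟨a, ha, b, coordMul_eq_one hu h hl hq.symm fun k hk1 hk2 => ?_,
    coordMul_eq_one hu h hl hq fun k hk1 hk2 => ?_⟩
  · rw [hae, hbf, hw (hu.mem_rootComp hk1.symm)]
    simp [hk1.symm, hk2.symm, hq]
  · rw [hae, hbf, ← lie_skew f e, neg_lie, hw (hu.mem_rootComp hk1.symm)]
    simp [hk1.symm, hk2.symm, hq.symm]

theorem IsBigradedLieAlgebra.iSupIndep_degree (h : IsBigradedLieAlgebra (typeA F l) 𝓛)
    (q : (typeA F l).rootSpan ℤ) : iSupIndep (𝓛 q) :=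
  h.indep.comp (f := fun a : Λ => (q, a)) fun _ _ e => (Prod.mk.inj e).2

theorem iSupIndep_coordGrading (h : IsLieTorus (typeA F l) 𝓛) (hl : 3 ≤ l) :
    iSupIndep (coordGrading 𝓛 u) := by
  rw [iSupIndep_iff_finsetSum_eq_zero_imp_eq_zero]
  intro s v hv h0 c hc
  obtain ⟨q, hq, -, -⟩ := exists_ne₃ hl 0 0 0
  refine coordSpace.eq_of_apply_eq hl hq.symm ?_
  refine (iSupIndep_iff_finsetSum_eq_zero_imp_eq_zero _).mp
    (h.iSupIndep_degree (latticeDiff F 0 q)) s (fun c => (v c).1 0 q)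
    (fun c hc => hv c hc 0 q hq.symm) ?_ c hc
  have := congrArg (fun a : coordSpace 𝓛 u => a.1 0 q) h0
  simpa using this

theorem iSup_coordGrading (hu : IsMatrixUnits 𝓛 u) (h : IsLieTorus (typeA F l) 𝓛) (hl : 3 ≤ l) :
    ⨆ c, coordGrading 𝓛 u c = ⊤ := by
  obtain ⟨q, hq, -, -⟩ := exists_ne₃ hl 0 0 0
  have key : ∀ x ∈ rootComp 𝓛 0 q, ∃ a ∈ ⨆ c, coordGrading 𝓛 u c, a.1 0 q = x := fun x hx => by
    induction hx using Submodule.iSup_induction' with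
    | mem c x hx =>
      obtain ⟨a, ha, hax⟩ := coordSpace.exists_mem_apply_eq hu h hl hq.symm hx
      exact ⟨a, Submodule.mem_iSup_of_mem c ha, hax⟩
    | zero => exact ⟨0, Submodule.zero_mem _, rfl⟩
    | add x y _ _ hx hy =>
      obtain ⟨a, ha, rfl⟩ := hx
      obtain ⟨b, hb, rfl⟩ := hy
      exact ⟨a + b, Submodule.add_mem _ ha hb, rfl⟩
  rw [eq_top_iff]
  rintro a -
  obtain ⟨b, hb, hba⟩ := key _ (a.2.2.1 0 q hq.symm)
  rwa [← coordSpace.eq_of_apply_eq hl hq.symm hba]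

/-- The element [u_0q, u_q0] acts as 2 on the nonzero component for ε_0 - ε_q, so u_0q ≠ 0. -/
theorem coordOne_ne_zero (hu : IsMatrixUnits 𝓛 u) (h : IsLieTorus (typeA F l) 𝓛) (hl : 3 ≤ l) :
    coordOne hu ≠ 0 := by
  obtain ⟨q, hq, -, -⟩ := exists_ne₃ hl 0 0 0
  intro h0
  obtain ⟨x, hx, hx0⟩ := Submodule.exists_mem_ne_zero_of_ne_bot (h.ne_bot hq.symm)
  have hu0 : u 0 q = 0 := by rw [← coordOne_apply hu hq.symm, h0]; rfl
  have := hu.weight hq.symm (mem_rootComp hx)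
  rw [hu0, zero_lie, zero_lie, eq_comm, smul_eq_zero] at this
  rcases this with h1 | h1
  · simp only [if_true, if_neg hq, if_neg hq.symm] at h1
    have : (2 : F) = 0 := by linear_combination h1
    exact two_ne_zero this
  · exact hx0 h1

theorem closure_coordGrading_supp (hu : IsMatrixUnits 𝓛 u) (h : IsLieTorus (typeA F l) 𝓛)
    (hZ : LieAlgebra.center F L = ⊥) (hl : 3 ≤ l) :
    AddSubgroup.closure {c : Λ | coordGrading 𝓛 u c ≠ ⊥} = ⊤ := by
  have hroot : ∀ {i j : Fin (l + 1)}, i ≠ j → ∀ {c : Λ} {x : L}, x ∈ 𝓛 (latticeDiff F i j) c →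
      x ≠ 0 → c ∈ AddSubgroup.closure {c : Λ | coordGrading 𝓛 u c ≠ ⊥} := by
    intro i j hij c x hx hx0
    refine AddSubgroup.subset_closure fun hb => hx0 ?_
    obtain ⟨a, ha, rfl⟩ := coordSpace.exists_mem_apply_eq hu h hl hij hx
    rw [hb, Submodule.mem_bot] at ha
    rw [ha]; rfl
  rw [eq_top_iff, ← h.closure_supp, AddSubgroup.closure_le]
  intro c hc
  have : ∃ q, 𝓛 q c ≠ ⊥ := by
    by_contra! hb
    exact hc (_root_.iSup_eq_bot.mpr hb)
  obtain ⟨q, hq⟩ := this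
  obtain ⟨i, j, rfl⟩ : ∃ i j, q = latticeDiff F i j := by
    by_contra! hne
    exact hq (h.eq_bot hne c)
  obtain ⟨x, hx, hx0⟩ := Submodule.exists_mem_ne_zero_of_ne_bot hq
  by_cases hij : i = j
  · subst hij
    -- A nonzero x over the root 0 fails to commute with some homogeneous root vector, as L is
    -- centreless. Then c is the difference of the degrees of two nonzero root vectors.
    by_contra hc'
    refine hx0 (h.eq_zero_of_lie_rootComp hZ fun r s hrs y hy => ?_)
    induction hy using Submodule.iSup_induction' with
    | zero => simp
    | add y z _ _ hy hz => rw [lie_add, hy, hz, add_zero]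
    | mem b y hy =>
      by_contra hne
      have hm := h.lie_mem _ _ _ _ x hx y hy
      rw [latticeDiff_self, zero_add] at hm
      have h1 := hroot hrs hm hne
      have h2 := hroot hrs hy fun h0 => hne (by rw [h0, lie_zero])
      exact hc' (by simpa using AddSubgroup.sub_mem _ h1 h2)
  · exact hroot hij hx hx0

theorem isAssociativeTorus_coordGrading (hu : IsMatrixUnits 𝓛 u) (h : IsLieTorus (typeA F l) 𝓛)
    (hZ : LieAlgebra.center F L = ⊥) (hl : 3 ≤ l) :
    letI := coordRing hu h hl
    letI := coordAlgebra hu h hl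
    IsAssociativeTorus (F := F) (coordGrading 𝓛 u) := by
  let _ := coordRing hu h hl
  let _ := coordAlgebra hu h hl
  refine
    { nontrivial := ⟨⟨coordOne hu, 0, coordOne_ne_zero hu h hl⟩⟩
      indep := iSupIndep_coordGrading h hl
      iSup_eq_top := iSup_coordGrading hu h hl
      mul_mem := fun c d a ha b hb i k hik => ?_
      exists_isUnit := fun c hc => ?_
      rank_le_one := fun c => ?_
      closure_supp := closure_coordGrading_supp hu h hZ hl }
  · obtain ⟨j, hj1, hj2, -⟩ := exists_ne₃ hl i k k
    change (coordMul hu h hl a b).1 i k ∈ _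
    rw [coordMul_apply hu h hl a b hj1.symm hj2 hik]
    exact h.lie_mem_latticeDiff (ha _ _ hj1.symm) (hb _ _ hj2)
  · obtain ⟨a, ha, b, hab, hba⟩ := exists_coordInv hu h hl hc
    exact ⟨a, ha, ⟨a, b, hab, hba⟩, rfl⟩
  · obtain ⟨q, hq, -, -⟩ := exists_ne₃ hl 0 0 0
    by_cases hb : 𝓛 (latticeDiff F 0 q) c = ⊥
    · have : coordGrading 𝓛 u c = ⊥ := by
        rw [eq_bot_iff]
        intro a ha
        rw [Submodule.mem_bot]
        refine coordSpace.eq_of_apply_eq hl hq.symm ?_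
        have := ha 0 q hq.symm
        rw [hb, Submodule.mem_bot] at this
        rw [this]; rfl
      rw [this, rank_bot]
      exact zero_le_one
    · obtain ⟨e, f, he, -⟩ := h.exists_sl2_latticeDiff hq.symm hb
      obtain ⟨a, ha, hae⟩ := coordSpace.exists_mem_apply_eq hu h hl hq.symm
        (he ▸ Submodule.mem_span_singleton_self e : e ∈ 𝓛 (latticeDiff F 0 q) c)
      refine (rank_submodule_le_one_iff' _).mpr ⟨a, fun b hb => ?_⟩
      have := hb 0 q hq.symm
      rw [he] at this
      obtain ⟨t, ht⟩ := Submodule.mem_span_singleton.mp this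
      refine Submodule.mem_span_singleton.mpr ⟨t, coordSpace.eq_of_apply_eq hl hq.symm ?_⟩
      rw [← ht, ← hae]
      rfl

end CoordinateAlgebra

/-! ### Gluing isomorphisms of root components -/

section Graph

variable {F L L' I : Type*} [Field F] [LieRing L] [LieAlgebra F L] [LieRing L'] [LieAlgebra F L']

/-- A graded Lie subalgebra of `L × L'` which is the graph of a bijection defines an isomorphism. -/
theorem exists_lieEquiv_of_graph {𝓛 : I → Submodule F L} {𝓛' : I → Submodule F L'}
    (hi : iSupIndep 𝓛) (hi' : iSupIndep 𝓛') (𝓗 : I → Submodule F (L × L'))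
    (hle : ∀ i, ∀ m ∈ 𝓗 i, m.1 ∈ 𝓛 i) (hle' : ∀ i, ∀ m ∈ 𝓗 i, m.2 ∈ 𝓛' i)
    (hinj : ∀ i, ∀ m ∈ 𝓗 i, m.2 = 0 → m.1 = 0) (hinj' : ∀ i, ∀ m ∈ 𝓗 i, m.1 = 0 → m.2 = 0)
    (K : LieSubalgebra F (L × L')) (hK : K.toSubmodule = ⨆ i, 𝓗 i)
    (hs : ∀ x, ∃ m ∈ K, m.1 = x) (hs' : ∀ y, ∃ m ∈ K, m.2 = y) :
    ∃ f : L ≃ₗ⁅F⁆ L', ∀ i, (𝓛 i).map (f : L →ₗ[F] L') = 𝓛' i := by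
  have hmem : ∀ {m}, m ∈ K ↔ m ∈ ⨆ i, 𝓗 i := fun {m} => by rw [← hK]; rfl
  have key : ∀ m ∈ K, m.1 = 0 ↔ m.2 = 0 := by
    intro m hm
    obtain ⟨v, hv, rfl⟩ := (Submodule.mem_iSup_iff_exists_finsupp 𝓗 m).mp (hmem.mp hm)
    have e1 : (v.sum fun _ x => x).1 = ∑ i ∈ v.support, (v i).1 := Prod.fst_sum
    have e2 : (v.sum fun _ x => x).2 = ∑ i ∈ v.support, (v i).2 := Prod.snd_sum
    rw [e1, e2]
    constructor
    · intro h0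
      exact Finset.sum_eq_zero fun i h => hinj' i _ (hv i)
        ((iSupIndep_iff_finsetSum_eq_zero_imp_eq_zero 𝓛).mp hi _ _
          (fun i _ => hle i _ (hv i)) h0 i h)
    · intro h0
      exact Finset.sum_eq_zero fun i h => hinj i _ (hv i)
        ((iSupIndep_iff_finsetSum_eq_zero_imp_eq_zero 𝓛').mp hi' _ _
          (fun i _ => hle' i _ (hv i)) h0 i h)
  have b1 : Function.Bijective ((LieHom.fst F L L').comp K.incl) := by
    refine ⟨(injective_iff_map_eq_zero _).mpr fun m hm => ?_, fun x => ?_⟩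
    · exact Subtype.ext (Prod.ext hm ((key m.1 m.2).mp hm))
    · obtain ⟨m, hm, rfl⟩ := hs x
      exact ⟨⟨m, hm⟩, rfl⟩
  have b2 : Function.Bijective ((LieHom.snd F L L').comp K.incl) := by
    refine ⟨(injective_iff_map_eq_zero _).mpr fun m hm => ?_, fun x => ?_⟩
    · exact Subtype.ext (Prod.ext ((key m.1 m.2).mpr hm) hm)
    · obtain ⟨m, hm, rfl⟩ := hs' x
      exact ⟨⟨m, hm⟩, rfl⟩
  -- A family lying termwise inside an independent one and still spanning everything must coincide
  -- with it.
  have t1 : (fun i => (𝓗 i).map (LinearMap.fst F L L')) = 𝓛 := by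
    refine (hi.le_iff_eq_of_iSup_eq_top ?_).mp fun i => ?_
    · rw [← Submodule.map_iSup, ← hK, eq_top_iff]
      rintro x -
      obtain ⟨m, hm, rfl⟩ := hs x
      exact ⟨m, hm, rfl⟩
    · rintro _ ⟨m, hm, rfl⟩
      exact hle i m hm
  have t2 : (fun i => (𝓗 i).map (LinearMap.snd F L L')) = 𝓛' := by
    refine (hi'.le_iff_eq_of_iSup_eq_top ?_).mp fun i => ?_
    · rw [← Submodule.map_iSup, ← hK, eq_top_iff]
      rintro x -
      obtain ⟨m, hm, rfl⟩ := hs' x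
      exact ⟨m, hm, rfl⟩
    · rintro _ ⟨m, hm, rfl⟩
      exact hle' i m hm
  set e1 := LieEquiv.ofBijective _ b1
  set e2 := LieEquiv.ofBijective _ b2
  have hf : ∀ m ∈ K, (e1.symm.trans e2) m.1 = m.2 := fun m hm => by
    have : e1.symm m.1 = ⟨m, hm⟩ := e1.injective (e1.apply_symm_apply _)
    rw [LieEquiv.trans_apply, this]
    rfl
  refine ⟨e1.symm.trans e2, fun i => ?_⟩
  rw [← t1, ← t2]
  have hKi : ∀ m ∈ 𝓗 i, m ∈ K := fun m hm => hmem.mpr (Submodule.mem_iSup_of_mem i hm)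
  ext y
  constructor
  · rintro ⟨_, ⟨m, hm, rfl⟩, rfl⟩
    exact ⟨m, hm, (hf m (hKi m hm)).symm⟩
  · rintro ⟨m, hm, rfl⟩
    exact ⟨_, ⟨m, hm, rfl⟩, hf m (hKi m hm)⟩

end Graph

/-! ### Extending a correspondence of root components to the whole Lie algebra -/

section Gluing

set_option linter.unusedSectionVars false

variable {F : Type*} [Field F] [CharZero F] {l : ℕ} {Λ : Type*} [AddCommGroup Λ]
  {L L' : Type*} [LieRing L] [LieAlgebra F L] [LieRing L'] [LieAlgebra F L']
  {𝓛 : (typeA F l).rootSpan ℤ → Λ → Submodule F L}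
  {𝓛' : (typeA F l).rootSpan ℤ → Λ → Submodule F L'}
  {G : Fin (l + 1) → Fin (l + 1) → Λ → Submodule F (L × L')}

/-- Graphs of bijections between the root components of two Lie tori which are compatible with
the brackets whose value lies in a root component. -/
structure IsRootGraph (𝓛 : (typeA F l).rootSpan ℤ → Λ → Submodule F L)
    (𝓛' : (typeA F l).rootSpan ℤ → Λ → Submodule F L')
    (G : Fin (l + 1) → Fin (l + 1) → Λ → Submodule F (L × L')) : Prop where
  fst_mem : ∀ {i j c g}, i ≠ j → g ∈ G i j c → g.1 ∈ 𝓛 (latticeDiff F i j) c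
  snd_mem : ∀ {i j c g}, i ≠ j → g ∈ G i j c → g.2 ∈ 𝓛' (latticeDiff F i j) c
  fst_surj : ∀ {i j c x}, i ≠ j → x ∈ 𝓛 (latticeDiff F i j) c → ∃ g ∈ G i j c, g.1 = x
  snd_surj : ∀ {i j c y}, i ≠ j → y ∈ 𝓛' (latticeDiff F i j) c → ∃ g ∈ G i j c, g.2 = y
  fst_inj : ∀ {i j c g}, i ≠ j → g ∈ G i j c → g.1 = 0 → g.2 = 0
  snd_inj : ∀ {i j c g}, i ≠ j → g ∈ G i j c → g.2 = 0 → g.1 = 0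
  lie_mem : ∀ {i j k c d g g'}, i ≠ j → j ≠ k → i ≠ k → g ∈ G i j c → g' ∈ G j k d →
    ⁅g, g'⁆ ∈ G i k (c + d)
  factor : ∀ {i j c g}, i ≠ j → g ∈ G i j c → ∃ k, k ≠ i ∧ k ≠ j ∧
    ∃ g₁ ∈ G i k c, ∃ g₂ ∈ G k j 0, ⁅g₁, g₂⁆ = g

namespace IsRootGraph

theorem lie_eq_zero (hG : IsRootGraph 𝓛 𝓛' G) (h : IsLieTorus (typeA F l) 𝓛)
    (h' : IsLieTorus (typeA F l) 𝓛') {i j k m : Fin (l + 1)} (h1 : i ≠ j) (h2 : i ≠ m)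
    (h3 : k ≠ j) (h4 : k ≠ m) {c d : Λ} {g g' : L × L'} (hg : g ∈ G i j c) (hg' : g' ∈ G k m d) :
    ⁅g, g'⁆ = 0 :=
  Prod.ext
    (h.lie_eq_zero h1 h2 h3 h4 (mem_rootComp (hG.fst_mem h1 hg)) (mem_rootComp (hG.fst_mem h4 hg')))
    (h'.lie_eq_zero h1 h2 h3 h4 (mem_rootComp (hG.snd_mem h1 hg))
      (mem_rootComp (hG.snd_mem h4 hg')))

theorem lie_lie_left (hG : IsRootGraph 𝓛 𝓛' G) (h : IsLieTorus (typeA F l) 𝓛)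
    (h' : IsLieTorus (typeA F l) 𝓛') {i j s : Fin (l + 1)} (hij : i ≠ j) (hsi : s ≠ i)
    (hsj : s ≠ j) {c d e : Λ} {m m' g : L × L'} (hm : m ∈ G i j c) (hm' : m' ∈ G j i d)
    (hg : g ∈ G i s e) : ⁅⁅m, m'⁆, g⁆ ∈ G i s (c + d + e) := by
  rw [lie_lie, hG.lie_eq_zero h h' hij hsi.symm hij hsi.symm hm hg, lie_zero, sub_zero, add_assoc]
  exact hG.lie_mem hij hsj.symm hsi.symm hm (hG.lie_mem hij.symm hsi.symm hsj.symm hm' hg)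

theorem lie_lie_right (hG : IsRootGraph 𝓛 𝓛' G) (h : IsLieTorus (typeA F l) 𝓛)
    (h' : IsLieTorus (typeA F l) 𝓛') {i j r : Fin (l + 1)} (hij : i ≠ j) (hri : r ≠ i)
    (hrj : r ≠ j) {c d e : Λ} {m m' g : L × L'} (hm : m ∈ G i j c) (hm' : m' ∈ G j i d)
    (hg : g ∈ G r j e) : ⁅⁅m, m'⁆, g⁆ ∈ G r j (c + d + e) := by
  rw [lie_lie, hG.lie_eq_zero h h' hij hij hrj hrj hm hg, lie_zero, sub_zero, ← lie_skew m',
    lie_neg, lie_skew]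
  have := hG.lie_mem hri hij hrj (hG.lie_mem hrj hij.symm hri hg hm') hm
  rwa [show e + d + c = c + d + e by abel] at this

/-- Case analysis on how {r, s} meets {i, j}. If they are disjoint the bracket is 0. If one index is
shared, Jacobi leaves a single iterated bracket, up to sign, whose steps all stay in root
components. If {r, s} = {i, j}, g is factored through a third index and [m, m'] acts as a
derivation, which reduces to the previous case. -/
theorem lie_lie_mem (hG : IsRootGraph 𝓛 𝓛' G) (h : IsLieTorus (typeA F l) 𝓛)
    (h' : IsLieTorus (typeA F l) 𝓛') {i j : Fin (l + 1)} (hij : i ≠ j) {c d : Λ} {m m' : L × L'}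
    (hm : m ∈ G i j c) (hm' : m' ∈ G j i d) {r s : Fin (l + 1)} (hrs : r ≠ s) {e : Λ} {g : L × L'}
    (hg : g ∈ G r s e) : ⁅⁅m, m'⁆, g⁆ ∈ G r s (c + d + e) := by
  have skew : ∀ {x : L × L'} {S : Submodule F (L × L')}, ⁅⁅m', m⁆, x⁆ ∈ S → ⁅⁅m, m'⁆, x⁆ ∈ S :=
    fun {x S} hx => by
      rw [← lie_skew m m', neg_lie]; exact S.neg_mem hx
  have hcd : d + c = c + d := add_comm d c
  have diag : ∀ {r s : Fin (l + 1)} {e : Λ} {g : L × L'}, r ≠ s → g ∈ G r s e →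
      (∀ k, k ≠ r → k ≠ s → (∀ e, ∀ g ∈ G r k e, ⁅⁅m, m'⁆, g⁆ ∈ G r k (c + d + e)) ∧
        ∀ e, ∀ g ∈ G k s e, ⁅⁅m, m'⁆, g⁆ ∈ G k s (c + d + e)) →
      ⁅⁅m, m'⁆, g⁆ ∈ G r s (c + d + e) := by
    intro r s e g hrs hg hk
    obtain ⟨k, hk1, hk2, g₁, hg₁, g₂, hg₂, rfl⟩ := hG.factor hrs hg
    obtain ⟨k1, k2⟩ := hk k hk1 hk2
    rw [leibniz_lie]
    refine Submodule.add_mem _ ?_ ?_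
    · simpa using hG.lie_mem hk1.symm hk2 hrs (k1 _ _ hg₁) hg₂
    · have := hG.lie_mem hk1.symm hk2 hrs hg₁ (k2 _ _ hg₂)
      rwa [show e + (c + d + 0) = c + d + e by abel] at this
  by_cases hri : r = i
  · subst hri
    by_cases hsj : s = j
    · subst hsj
      exact diag hrs hg fun k hk1 hk2 =>
        ⟨fun e g hg => hG.lie_lie_left h h' hij hk1 hk2 hm hm' hg,
          fun e g hg => hG.lie_lie_right h h' hij hk1 hk2 hm hm' hg⟩
    · exact hG.lie_lie_left h h' hij hrs.symm hsj hm hm' hg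
  by_cases hrj : r = j
  · subst hrj
    by_cases hsi : s = i
    · subst hsi
      exact diag hrs hg fun k hk1 hk2 =>
        ⟨fun e g hg => skew (hcd ▸ hG.lie_lie_left h h' hrs hk1 hk2 hm' hm hg),
          fun e g hg => skew (hcd ▸ hG.lie_lie_right h h' hrs hk1 hk2 hm' hm hg)⟩
    · exact skew (hcd ▸ hG.lie_lie_left h h' hij.symm hrs.symm hsi hm' hm hg)
  by_cases hsj : s = j
  · subst hsj
    exact hG.lie_lie_right h h' hij hri hrs hm hm' hg
  by_cases hsi : s = i
  · subst hsi
    exact skew (hcd ▸ hG.lie_lie_right h h' hij.symm hrj hri hm' hm hg)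
  rw [lie_lie, hG.lie_eq_zero h h' hij (Ne.symm hsi) hrj hrs hm hg,
    hG.lie_eq_zero h h' hij.symm (Ne.symm hsj) hri hrs hm' hg]
  simp

variable (𝓛 𝓛' G) in
/-- The homogeneous components of the graph of the isomorphism defined by a root graph. -/
def homogeneous (q : (typeA F l).rootSpan ℤ) (c : Λ) : Submodule F (L × L') where
  -- Over the root 0 no graph is given, so the pairs are singled out by their action on the root
  -- graphs; in centreless algebras this action determines them.
  carrier := {m | m.1 ∈ 𝓛 q c ∧ m.2 ∈ 𝓛' q c ∧
    (∀ i j, i ≠ j → q = latticeDiff F i j → m ∈ G i j c) ∧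
    (q = 0 → ∀ i j d, i ≠ j → ∀ g ∈ G i j d, ⁅m, g⁆ ∈ G i j (c + d))}
  add_mem' := by
    rintro a b ⟨a1, a2, a3, a4⟩ ⟨b1, b2, b3, b4⟩
    refine ⟨Submodule.add_mem _ a1 b1, Submodule.add_mem _ a2 b2, fun i j hij hq =>
      Submodule.add_mem _ (a3 i j hij hq) (b3 i j hij hq), fun hq i j d hij g hg => ?_⟩
    rw [add_lie]
    exact Submodule.add_mem _ (a4 hq i j d hij g hg) (b4 hq i j d hij g hg)
  zero_mem' := ⟨Submodule.zero_mem _, Submodule.zero_mem _, fun _ _ _ _ => Submodule.zero_mem _,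
    fun _ i j d hij g hg => by rw [zero_lie]; exact Submodule.zero_mem _⟩
  smul_mem' := by
    rintro t a ⟨a1, a2, a3, a4⟩
    refine ⟨Submodule.smul_mem _ t a1, Submodule.smul_mem _ t a2, fun i j hij hq =>
      Submodule.smul_mem _ t (a3 i j hij hq), fun hq i j d hij g hg => ?_⟩
    rw [smul_lie]
    exact Submodule.smul_mem _ t (a4 hq i j d hij g hg)

theorem le_homogeneous (hG : IsRootGraph 𝓛 𝓛' G) {i j : Fin (l + 1)} (hij : i ≠ j) {c : Λ}
    {g : L × L'} (hg : g ∈ G i j c) : g ∈ homogeneous 𝓛 𝓛' G (latticeDiff F i j) c := by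
  refine ⟨hG.fst_mem hij hg, hG.snd_mem hij hg, fun r s hrs e => ?_, fun h0 => ?_⟩
  · obtain ⟨rfl, rfl⟩ := latticeDiff_inj hij e
    exact hg
  · exact absurd h0 (latticeDiff_ne_zero hij)

theorem homogeneous_latticeDiff {i j : Fin (l + 1)} (hij : i ≠ j) {c : Λ} {g : L × L'}
    (hg : g ∈ homogeneous 𝓛 𝓛' G (latticeDiff F i j) c) : g ∈ G i j c := hg.2.2.1 i j hij rfl

theorem lattice_cases (h : IsLieTorus (typeA F l) 𝓛) (h' : IsLieTorus (typeA F l) 𝓛')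
    {q : (typeA F l).rootSpan ℤ} {c : Λ} {m : L × L'} (hm : m ∈ homogeneous 𝓛 𝓛' G q c) :
    q = 0 ∨ (∃ i j, i ≠ j ∧ q = latticeDiff F i j) ∨ m = 0 := by
  by_cases hq : ∃ i j, q = latticeDiff F i j
  · obtain ⟨i, j, rfl⟩ := hq
    by_cases hij : i = j
    · subst hij; exact Or.inl (latticeDiff_self i)
    · exact Or.inr (Or.inl ⟨i, j, hij, rfl⟩)
  · push Not at hq
    have h1 := hm.1
    have h2 := hm.2.1
    rw [h.eq_bot hq, Submodule.mem_bot] at h1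
    rw [h'.eq_bot hq, Submodule.mem_bot] at h2
    exact Or.inr (Or.inr (Prod.ext h1 h2))

theorem lie_mem_homogeneous (hG : IsRootGraph 𝓛 𝓛' G) (h : IsLieTorus (typeA F l) 𝓛)
    (h' : IsLieTorus (typeA F l) 𝓛') {p q : (typeA F l).rootSpan ℤ} {c d : Λ} {m m' : L × L'}
    (hm : m ∈ homogeneous 𝓛 𝓛' G p c) (hm' : m' ∈ homogeneous 𝓛 𝓛' G q d) :
    ⁅m, m'⁆ ∈ homogeneous 𝓛 𝓛' G (p + q) (c + d) := by
  have hl1 : ⁅m, m'⁆.1 ∈ 𝓛 (p + q) (c + d) := h.lie_mem _ _ _ _ _ hm.1 _ hm'.1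
  have hl2 : ⁅m, m'⁆.2 ∈ 𝓛' (p + q) (c + d) := h'.lie_mem _ _ _ _ _ hm.2.1 _ hm'.2.1
  rcases lattice_cases h h' hm with rfl | ⟨i, j, hij, rfl⟩ | rfl
  · rcases lattice_cases h h' hm' with rfl | ⟨i, j, hij, rfl⟩ | rfl
    · refine ⟨hl1, hl2, fun i j hij hq => ?_, fun _ i j e hij g hg => ?_⟩
      · rw [add_zero] at hq
        exact absurd hq.symm (latticeDiff_ne_zero hij)
      · rw [lie_lie]
        refine Submodule.sub_mem _ ?_ ?_
        · rw [add_assoc]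
          exact hm.2.2.2 rfl i j _ hij _ (hm'.2.2.2 rfl i j _ hij g hg)
        · rw [show c + d + e = d + (c + e) by abel]
          exact hm'.2.2.2 rfl i j _ hij _ (hm.2.2.2 rfl i j _ hij g hg)
    · rw [zero_add]
      exact hG.le_homogeneous hij (hm.2.2.2 rfl i j d hij m' (homogeneous_latticeDiff hij hm'))
    · rw [lie_zero]; exact Submodule.zero_mem _
  · have hg := homogeneous_latticeDiff hij hm
    rcases lattice_cases h h' hm' with rfl | ⟨r, s, hrs, rfl⟩ | rfl
    · rw [add_zero, add_comm c d, ← lie_skew]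
      exact Submodule.neg_mem _ (hG.le_homogeneous hij (hm'.2.2.2 rfl i j c hij m hg))
    · have hg' := homogeneous_latticeDiff hrs hm'
      by_cases hjr : j = r
      · subst hjr
        by_cases his : i = s
        · subst his
          rw [latticeDiff_add, latticeDiff_self] at hl1 hl2 ⊢
          exact ⟨hl1, hl2, fun r s hrs hq => absurd hq.symm (latticeDiff_ne_zero hrs),
            fun _ r s e hrs g hg'' => hG.lie_lie_mem h h' hij hg hg' hrs hg''⟩
        · rw [latticeDiff_add]
          exact hG.le_homogeneous his (hG.lie_mem hij hrs his hg hg')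
      · by_cases his : i = s
        · subst his
          rw [add_comm (latticeDiff F i j), latticeDiff_add, add_comm c d, ← lie_skew]
          exact Submodule.neg_mem _ (hG.le_homogeneous (Ne.symm hjr)
            (hG.lie_mem hrs hij (Ne.symm hjr) hg' hg))
        · rw [hG.lie_eq_zero h h' hij his (Ne.symm hjr) hrs hg hg']
          exact Submodule.zero_mem _
    · rw [lie_zero]; exact Submodule.zero_mem _
  · rw [zero_lie]; exact Submodule.zero_mem _

/-- Over the root 0, if m.2 = 0 then each [m, g] lies in a root graph with second coordinate 0, so
its first coordinate vanishes too. Hence m.1 kills all root components, and L is centreless. -/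
theorem homogeneous_snd_inj (hG : IsRootGraph 𝓛 𝓛' G) (h : IsLieTorus (typeA F l) 𝓛)
    (h' : IsLieTorus (typeA F l) 𝓛') (hZ : LieAlgebra.center F L = ⊥)
    {q : (typeA F l).rootSpan ℤ} {c : Λ} {m : L × L'} (hm : m ∈ homogeneous 𝓛 𝓛' G q c)
    (h0 : m.2 = 0) : m.1 = 0 := by
  rcases lattice_cases h h' hm with rfl | ⟨i, j, hij, rfl⟩ | rfl
  · refine h.eq_zero_of_lie_rootComp hZ fun i j hij y hy => ?_
    induction hy using Submodule.iSup_induction' with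
    | zero => simp
    | add y z _ _ hy hz => rw [lie_add, hy, hz, add_zero]
    | mem d y hy =>
      obtain ⟨g, hg, rfl⟩ := hG.fst_surj hij hy
      refine hG.snd_inj hij (hm.2.2.2 rfl i j d hij g hg) ?_
      change ⁅m.2, g.2⁆ = 0
      rw [h0, zero_lie]
  · exact hG.snd_inj hij (homogeneous_latticeDiff hij hm) h0
  · rfl

theorem homogeneous_fst_inj (hG : IsRootGraph 𝓛 𝓛' G) (h : IsLieTorus (typeA F l) 𝓛)
    (h' : IsLieTorus (typeA F l) 𝓛') (hZ' : LieAlgebra.center F L' = ⊥)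
    {q : (typeA F l).rootSpan ℤ} {c : Λ} {m : L × L'} (hm : m ∈ homogeneous 𝓛 𝓛' G q c)
    (h0 : m.1 = 0) : m.2 = 0 := by
  rcases lattice_cases h h' hm with rfl | ⟨i, j, hij, rfl⟩ | rfl
  · refine h'.eq_zero_of_lie_rootComp hZ' fun i j hij y hy => ?_
    induction hy using Submodule.iSup_induction' with
    | zero => simp
    | add y z _ _ hy hz => rw [lie_add, hy, hz, add_zero]
    | mem d y hy =>
      obtain ⟨g, hg, rfl⟩ := hG.snd_surj hij hy
      refine hG.fst_inj hij (hm.2.2.2 rfl i j d hij g hg) ?_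
      change ⁅m.1, g.1⁆ = 0
      rw [h0, zero_lie]
  · exact hG.fst_inj hij (homogeneous_latticeDiff hij hm) h0
  · rfl

/-- The graph of the isomorphism defined by a root graph. -/
def graph (hG : IsRootGraph 𝓛 𝓛' G) (h : IsLieTorus (typeA F l) 𝓛)
    (h' : IsLieTorus (typeA F l) 𝓛') : LieSubalgebra F (L × L') where
  toSubmodule := ⨆ x : (typeA F l).rootSpan ℤ × Λ, homogeneous 𝓛 𝓛' G x.1 x.2
  lie_mem' := by
    intro m m' hm hm'
    induction hm using Submodule.iSup_induction' with
    | zero => rw [zero_lie]; exact Submodule.zero_mem _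
    | add x y _ _ hx hy => rw [add_lie]; exact Submodule.add_mem _ hx hy
    | mem i m hm =>
    induction hm' using Submodule.iSup_induction' with
    | zero => rw [lie_zero]; exact Submodule.zero_mem _
    | add x y _ _ hx hy => rw [lie_add]; exact Submodule.add_mem _ hx hy
    | mem j m' hm' =>
      exact Submodule.mem_iSup_of_mem (i + j) (hG.lie_mem_homogeneous h h' hm hm')

theorem mem_graph (hG : IsRootGraph 𝓛 𝓛' G) (h : IsLieTorus (typeA F l) 𝓛)
    (h' : IsLieTorus (typeA F l) 𝓛') {i j : Fin (l + 1)} (hij : i ≠ j) {c : Λ} {g : L × L'}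
    (hg : g ∈ G i j c) : g ∈ hG.graph h h' :=
  Submodule.mem_iSup_of_mem (latticeDiff F i j, c) (hG.le_homogeneous hij hg)

/-- A root graph between centreless Lie tori of type `A_l` extends to a graded isomorphism. -/
theorem isGradedIsomorphic (hG : IsRootGraph 𝓛 𝓛' G) (h : IsLieTorus (typeA F l) 𝓛)
    (h' : IsLieTorus (typeA F l) 𝓛') (hZ : LieAlgebra.center F L = ⊥)
    (hZ' : LieAlgebra.center F L' = ⊥) : IsGradedIsomorphic (typeA F l) 𝓛 𝓛' := by
  -- The projection of the graph is a subalgebra containing the root components, which generate.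
  have s1 : (hG.graph h h').map (LieHom.fst F L L') = ⊤ := by
    rw [eq_top_iff, ← h.generated, LieSubalgebra.lieSpan_le]
    rintro x hx
    obtain ⟨⟨⟨i, j⟩, hij⟩, hx⟩ := Set.mem_iUnion.mp hx
    refine (iSup_le fun c x hx => ?_ : (⨆ c, 𝓛 (latticeDiff F i j) c) ≤
      ((hG.graph h h').map (LieHom.fst F L L')).toSubmodule) hx
    obtain ⟨g, hg, rfl⟩ := hG.fst_surj hij hx
    exact ⟨g, hG.mem_graph h h' hij hg, rfl⟩
  have s2 : (hG.graph h h').map (LieHom.snd F L L') = ⊤ := by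
    rw [eq_top_iff, ← h'.generated, LieSubalgebra.lieSpan_le]
    rintro x hx
    obtain ⟨⟨⟨i, j⟩, hij⟩, hx⟩ := Set.mem_iUnion.mp hx
    refine (iSup_le fun c x hx => ?_ : (⨆ c, 𝓛' (latticeDiff F i j) c) ≤
      ((hG.graph h h').map (LieHom.snd F L L')).toSubmodule) hx
    obtain ⟨g, hg, rfl⟩ := hG.snd_surj hij hx
    exact ⟨g, hG.mem_graph h h' hij hg, rfl⟩
  obtain ⟨f, hf⟩ := exists_lieEquiv_of_graph h.indep h'.indep
    (fun x : (typeA F l).rootSpan ℤ × Λ => homogeneous 𝓛 𝓛' G x.1 x.2)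
    (fun _ _ hm => hm.1) (fun _ _ hm => hm.2.1)
    (fun _ _ hm => hG.homogeneous_snd_inj h h' hZ hm)
    (fun _ _ hm => hG.homogeneous_fst_inj h h' hZ' hm) (hG.graph h h') rfl
    (fun x => by
      have : x ∈ (hG.graph h h').map (LieHom.fst F L L') := by rw [s1]; trivial
      exact this)
    (fun x => by
      have : x ∈ (hG.graph h h').map (LieHom.snd F L L') := by rw [s2]; trivial
      exact this)
  exact ⟨f, fun q a => hf (q, a)⟩

end IsRootGraph

end Gluing

/-! ### Transport along graded isomorphisms -/

section Transport

set_option linter.unusedSectionVars false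

variable {ι F Y Y' Λ L L' : Type*} [Field F] [CharZero F]
  [AddCommGroup Y] [Module F Y] [AddCommGroup Y'] [Module F Y'] [AddCommGroup Λ]
  [LieRing L] [LieAlgebra F L] [LieRing L'] [LieAlgebra F L'] {P : RootPairing ι F Y Y'}
  {𝓛 : P.rootSpan ℤ → Λ → Submodule F L} {𝓛' : P.rootSpan ℤ → Λ → Submodule F L'}

theorem IsGradedIsomorphic.symm (h : IsGradedIsomorphic P 𝓛 𝓛') : IsGradedIsomorphic P 𝓛' 𝓛 := by
  obtain ⟨f, hf⟩ := h
  refine ⟨f.symm, fun q a => ?_⟩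
  rw [← hf q a, ← Submodule.map_comp]
  have : (f.symm : L' →ₗ[F] L) ∘ₗ (f : L →ₗ[F] L') = LinearMap.id := by
    ext x
    exact f.symm_apply_apply x
  rw [this, Submodule.map_id]

theorem IsBigradedLieAlgebra.of_isGradedIsomorphic (h : IsBigradedLieAlgebra P 𝓛)
    (e : IsGradedIsomorphic P 𝓛 𝓛') : IsBigradedLieAlgebra P 𝓛' := by
  obtain ⟨f, hf⟩ := e
  obtain rfl : 𝓛' = fun q a => (𝓛 q a).map (f : L →ₗ[F] L') := by
    funext q a; exact (hf q a).symm
  constructor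
  · exact h.indep.map_orderIso (Submodule.orderIsoMapComap f.toLinearEquiv)
  · rw [← Submodule.map_iSup, h.iSup_eq_top, Submodule.map_top, LinearMap.range_eq_top]
    exact f.surjective
  · rintro p q a b _ ⟨x, hx, rfl⟩ _ ⟨y, hy, rfl⟩
    exact ⟨⁅x, y⁆, h.lie_mem p q a b x hx y hy, f.map_lie x y⟩

theorem IsLieTorus.of_isGradedIsomorphic (h : IsLieTorus P 𝓛)
    (e : IsGradedIsomorphic P 𝓛 𝓛') : IsLieTorus P 𝓛' := by
  have hb := h.toIsBigradedLieAlgebra.of_isGradedIsomorphic e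
  obtain ⟨f, hf⟩ := e
  obtain rfl : 𝓛' = fun q a => (𝓛 q a).map (f : L →ₗ[F] L') := by
    funext q a; exact (hf q a).symm
  refine ⟨hb, ?_, ?_, ?_, ?_, ?_⟩
  · intro q hq
    refine h.supp_subset q fun hb => hq ?_
    rw [← Submodule.map_iSup, hb, Submodule.map_bot]
  · intro i a ha
    obtain ⟨x, y, hx, hy, hxy⟩ := h.exists_sl2 i a fun hb => ha (by rw [hb, Submodule.map_bot])
    refine ⟨f x, f y, ?_, ?_, fun τ z hz => ?_⟩
    · rw [hx, Submodule.map_span, Set.image_singleton]; rfl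
    · rw [hy, Submodule.map_span, Set.image_singleton]; rfl
    · rw [← Submodule.map_iSup] at hz
      obtain ⟨z, hz, rfl⟩ := hz
      have := congrArg f (hxy τ z hz)
      rw [LieEquiv.map_lie, LieEquiv.map_lie] at this
      exact this.trans (map_smul f _ _)
  · intro i hi hb
    exact h.indivisible_ne_bot i hi ((Submodule.map_eq_bot_iff (e := f.toLinearEquiv)).mp hb)
  · rw [eq_top_iff]
    rintro y -
    have key : LieSubalgebra.lieSpan F L
        (⋃ i : ι, ((⨆ a, 𝓛 (P.rootSpanMem ℤ i) a : Submodule F L) : Set L)) ≤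
        (LieSubalgebra.lieSpan F L' (⋃ i : ι, ((⨆ a, (𝓛 (P.rootSpanMem ℤ i) a).map
          (f : L →ₗ[F] L') : Submodule F L') : Set L'))).comap f.toLieHom := by
      rw [LieSubalgebra.lieSpan_le]
      intro x hx
      obtain ⟨i, hi⟩ := Set.mem_iUnion.mp hx
      refine LieSubalgebra.subset_lieSpan (Set.mem_iUnion.mpr ⟨i, ?_⟩)
      rw [← Submodule.map_iSup]
      exact ⟨x, hi, rfl⟩
    rw [h.generated] at key
    have := (LieSubalgebra.mem_comap _ _).mp (key (LieSubalgebra.mem_top (f.symm y)))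
    rwa [LieEquiv.coe_toLieHom, f.apply_symm_apply] at this
  · rw [eq_top_iff, ← h.closure_supp]
    refine AddSubgroup.closure_mono fun a (ha : (⨆ q, 𝓛 q a) ≠ ⊥) hb => ha ?_
    rw [← Submodule.map_iSup] at hb
    exact (Submodule.map_eq_bot_iff (e := f.toLinearEquiv)).mp hb

theorem center_eq_bot_of_lieEquiv (f : L ≃ₗ⁅F⁆ L') (h : LieAlgebra.center F L' = ⊥) :
    LieAlgebra.center F L = ⊥ := by
  rw [eq_bot_iff]
  intro x hx
  rw [LieModule.mem_maxTrivSubmodule] at hx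
  have : f x ∈ LieAlgebra.center F L' := by
    rw [LieModule.mem_maxTrivSubmodule]
    intro y
    rw [← f.apply_symm_apply y, ← LieEquiv.map_lie, hx, map_zero]
  rw [h, LieSubmodule.mem_bot] at this
  rw [LieSubmodule.mem_bot]
  exact f.injective (this.trans (map_zero f).symm)

end Transport

/-! ### Coordinatization -/

section Coordinatization

variable {F : Type*} [Field F] [CharZero F] {l : ℕ} {Λ : Type*} [AddCommGroup Λ]

theorem IsLieTorus.exists_coordinates {L : Type u} [LieRing L] [LieAlgebra F L]
    {𝓛 : (typeA F l).rootSpan ℤ → Λ → Submodule F L} (h : IsLieTorus (typeA F l) 𝓛)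
    (hZ : LieAlgebra.center F L = ⊥) (hl : 3 ≤ l) :
    ∃ (A : Type u) (_ : Ring A) (_ : Algebra F A) (𝒜 : Λ → Submodule F A),
      IsAssociativeTorus 𝒜 ∧ IsGradedIsomorphic (typeA F l) 𝓛 (slGrading F l 𝒜) := by
  obtain ⟨u, hu⟩ := h.exists_matrixUnits
  let _ := coordRing hu h hl
  let _ := coordAlgebra hu h hl
  have h𝒜 := isAssociativeTorus_coordGrading hu h hZ hl
  refine ⟨coordSpace 𝓛 u, inferInstance, inferInstance, coordGrading 𝓛 u, h𝒜, ?_⟩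
  have hl1 : 1 ≤ l := by omega
  let ev : Fin (l + 1) → Fin (l + 1) → coordSpace 𝓛 u →ₗ[F] L := fun i j =>
    (LinearMap.proj j ∘ₗ LinearMap.proj i) ∘ₗ (coordSpace 𝓛 u).subtype
  -- The member a_ij of a homogeneous family is matched with the matrix a E_ij.
  let G : Fin (l + 1) → Fin (l + 1) → Λ → Submodule F (L × slAlg F l (coordSpace 𝓛 u)) :=
    fun i j c => if hij : i ≠ j then
      (coordGrading 𝓛 u c).map ((ev i j).prod (slSingle F hij)) else ⊥
  have hGm : ∀ {i j c} (hij : i ≠ j) {g}, g ∈ G i j c ↔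
      ∃ a ∈ coordGrading 𝓛 u c, (a.1 i j, slSingle F hij a) = g := fun {i j c} hij {g} => by
    simp only [G, dif_pos hij]
    rfl
  have hG : IsRootGraph 𝓛 (slGrading F l (coordGrading 𝓛 u)) G := by
    constructor
    · intro i j c g hij hg
      obtain ⟨a, ha, rfl⟩ := (hGm hij).mp hg
      exact ha i j hij
    · intro i j c g hij hg
      obtain ⟨a, ha, rfl⟩ := (hGm hij).mp hg
      exact slSingle_mem hij ha
    · intro i j c x hij hx
      obtain ⟨a, ha, rfl⟩ := coordSpace.exists_mem_apply_eq hu h hl hij hx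
      exact ⟨_, (hGm hij).mpr ⟨a, ha, rfl⟩, rfl⟩
    · intro i j c y hij hy
      exact ⟨_, (hGm hij).mpr ⟨y.1 i j, hy.2 i j, rfl⟩,
        (mem_slRootSpace_latticeDiff hij hy.1).symm⟩
    · intro i j c g hij hg h0
      obtain ⟨a, ha, rfl⟩ := (hGm hij).mp hg
      have : a = 0 := coordSpace.eq_of_apply_eq hl hij h0
      change slSingle F hij a = 0
      rw [this, map_zero]
    · intro i j c g hij hg h0
      obtain ⟨a, ha, rfl⟩ := (hGm hij).mp hg
      have : a = 0 := slSingle_injective (F := F) hij (h0.trans (map_zero _).symm)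
      change a.1 i j = 0
      rw [this]; rfl
    · intro i j k c d g g' hij hjk hik hg hg'
      obtain ⟨a, ha, rfl⟩ := (hGm hij).mp hg
      obtain ⟨b, hb, rfl⟩ := (hGm hjk).mp hg'
      refine (hGm hik).mpr ⟨a * b, h𝒜.mul_mem _ _ _ ha _ hb, Prod.ext ?_ ?_⟩
      · exact coordMul_apply hu h hl a b hij hjk hik
      · exact (slSingle_lie hij hjk hik a b).symm
    · intro i j c g hij hg
      obtain ⟨a, ha, rfl⟩ := (hGm hij).mp hg
      obtain ⟨k, hk1, hk2, -⟩ := exists_ne₃ hl i j j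
      refine ⟨k, hk1, hk2, _, (hGm hk1.symm).mpr ⟨a, ha, rfl⟩, _,
        (hGm hk2).mpr ⟨1, h𝒜.one_mem, rfl⟩, Prod.ext ?_ ?_⟩
      · change ⁅a.1 i k, (coordOne hu).1 k j⁆ = a.1 i j
        rw [coordOne_apply hu hk2, a.2.2.2.1 i k j hk1.symm hk2 hij]
      · change ⁅slSingle F hk1.symm a, slSingle F hk2 1⁆ = slSingle F hij a
        rw [slSingle_lie hk1.symm hk2 hij, mul_one]
  exact hG.isGradedIsomorphic h (h𝒜.isLieTorus hl1) hZ (h𝒜.center_slAlg hl1)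

theorem IsGradedIsomorphic.isInvariantLieTorus {L A : Type*} [LieRing L] [LieAlgebra F L]
    [Ring A] [Algebra F A] {𝓛 : (typeA F l).rootSpan ℤ → Λ → Submodule F L}
    {𝒜 : Λ → Submodule F A} (h𝒜 : IsAssociativeTorus 𝒜) (hl : 1 ≤ l)
    (e : IsGradedIsomorphic (typeA F l) 𝓛 (slGrading F l 𝒜)) :
    IsInvariantLieTorus (typeA F l) 𝓛 := by
  refine ⟨(h𝒜.isLieTorus hl).of_isGradedIsomorphic e.symm, ?_⟩
  obtain ⟨f, hf⟩ := e
  obtain ⟨B, b1, b2, b3, b4⟩ := h𝒜.exists_form (F := F) hl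
  refine ⟨B.compl₁₂ (f : L →ₗ[F] slAlg F l A) (f : L →ₗ[F] slAlg F l A), fun x y => b1 _ _,
    fun x y z => ?_, fun x hx => ?_, fun p q a b hpq x hx y hy => ?_⟩
  · change B (f ⁅x, y⁆) (f z) = B (f x) (f ⁅y, z⁆)
    rw [LieEquiv.map_lie, LieEquiv.map_lie, b2]
  · refine f.injective ((b3 (f x) fun y => ?_).trans (map_zero f).symm)
    have := hx (f.symm y)
    change B (f x) (f (f.symm y)) = 0 at this
    rwa [f.apply_symm_apply] at this
  · exact b4 p q a b hpq (f x) (hf p a ▸ ⟨x, hx, rfl⟩) (f y) (hf q b ▸ ⟨y, hy, rfl⟩)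

end Coordinatization

theorem theoremn {F : Type*} [Field F] [CharZero F] {Λ : Type*} [AddCommGroup Λ]
    (l : ℕ) (hl : 3 ≤ l) {L : Type u} [LieRing L] [LieAlgebra F L]
    (𝓛 : (typeA F l).rootSpan ℤ → Λ → Submodule F L) :
    ((IsLieTorus (typeA F l) 𝓛 ∧ LieAlgebra.center F L = ⊥) ↔
      ∃ (A : Type u) (_ : Ring A) (_ : Algebra F A) (𝒜 : Λ → Submodule F A),
        IsAssociativeTorus 𝒜 ∧ IsGradedIsomorphic (typeA F l) 𝓛 (slGrading F l 𝒜)) ∧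
    (IsLieTorus (typeA F l) 𝓛 ∧ LieAlgebra.center F L = ⊥ →
      IsInvariantLieTorus (typeA F l) 𝓛) := by
  have hl1 : 1 ≤ l := by omega
  refine ⟨⟨fun h => h.1.exists_coordinates h.2 hl, ?_⟩, fun h => ?_⟩
  · rintro ⟨A, _, _, 𝒜, h𝒜, e⟩
    refine ⟨(h𝒜.isLieTorus hl1).of_isGradedIsomorphic e.symm, ?_⟩
    obtain ⟨f, -⟩ := e
    exact center_eq_bot_of_lieEquiv f (h𝒜.center_slAlg hl1)
  · obtain ⟨A, _, _, 𝒜, h𝒜, e⟩ := h.1.exists_coordinates h.2 hl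
    exact e.isInvariantLieTorus h𝒜 hl1
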